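/- Let $q=p^h$ with $p$ prime and $h\ge 1$, and let $r\ge 3$. A finite classical polar space consists of the totally isotropic subspaces of a finite-dimensional vector space $V$ over a finite field with respect to a non-degenerate alternating or Hermitian form, or of the totally singular subspaces with respect to a non-degenerate quadratic form. Its points are its elements of vector space dimension $1$, its rank is the largest vector space dimension of an element, its generators are the elements of that dimension, and a partial $2$-ovoid is a set of points that meets every generator in at most two points. Let $\mathcal{O}_2$ be a partial $2$-ovoid of a finite classical polar space $\mathcal{P}$ of rank $r$. Binomial coefficients with negative lower index are $0$. 1. If $\mathcal{P}=\mathsf{W}(2r-1,q)$, i.e. $\mathcal{P}$ is given by a non-degenerate alternating form on $V=\mathbb{F}_q^{2r}$, then $$|\mathcal{O}_2|\le q^{r}+q+1+q\binom{p+2r-3}{p-1}^h.$$ 2. If $\mathcal{P}=\mathsf{Q}^\varepsilon(n-1,q)$ with $(n,\varepsilon)\in\{(2r,1),(2r+1,0),(2r+2,-1)\}$, i.e. $\mathcal{P}$ is the hyperbolic ($\varepsilon=1$), parabolic ($\varepsilon=0$) or elliptic ($\varepsilon=-1$) quadric of rank $r$, given by a non-degenerate quadratic form on $V=\mathbb{F}_q^{n}$,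 then $$|\mathcal{O}_2|\le q^{r-\varepsilon}+q+1+q\left[\binom{n+p-4}{p-1}-\binom{n+p-6}{p-3}\right]^h.$$ 3. If $\mathcal{P}=\mathsf{H}(n-1,q^2)$, i.e. $\mathcal{P}$ is given by a non-degenerate Hermitian form (with respect to $x\mapsto x^q$) on $V=\mathbb{F}_{q^2}^{n}$, then $$|\mathcal{O}_2|\le q^{2r+1}+q^2+1+q^2\left[\binom{n+p-4}{p-1}^2-\binom{n+p-5}{p-2}^2\right]^h\quad\text{if } n \text{ is odd},$$ $$|\mathcal{O}_2|\le q^{2r-1}+q^2+1+q^2\left[\binom{n+p-4}{p-1}^2-\binom{n+p-5}{p-2}^2\right]^h\quad\text{if } n \text{ is even}.$$ -/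

import Mathlib

open scoped LinearAlgebra.Projectivization

namespace PolarSpace

variable {K V : Type*} [Field K] [AddCommGroup V] [Module K V]

/-- `W` is totally isotropic for the sesquilinear (in particular: bilinear) form `B`. -/
def TotallyIsotropic {σ : K →+* K} (B : V →ₛₗ[σ] V →ₗ[K] K) (W : Submodule K V) : Prop :=
  ∀ x ∈ W, ∀ y ∈ W, B x y = 0

/-- `W` is totally singular for the quadratic form `Q`. -/
def TotallySingular (Q : QuadraticForm K V) (W : Submodule K V) : Prop :=
  ∀ x ∈ W, Q x = 0

/-! Below, `S` is the family of (vector) subspaces that are elements of a polar space: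
`TotallyIsotropic B` or `TotallySingular Q`. -/

/-- The polar space has rank `r`: the largest (vector space) dimension of an element is `r`. -/
def HasRank (S : Submodule K V → Prop) (r : ℕ) : Prop :=
  IsGreatest {d : ℕ | ∃ W : Submodule K V, S W ∧ Module.finrank K W = d} r

/-- The generators are the elements of maximal dimension. -/
def IsGenerator (S : Submodule K V → Prop) (W : Submodule K V) : Prop :=
  S W ∧ ∀ U : Submodule K V, S U → Module.finrank K U ≤ Module.finrank K W

/-- A partial `m`-ovoid: a set of points of the polar space that meets every generator in at most
`m` points. -/
def IsPartialOvoid (S : Submodule K V → Prop) (m : ℕ) (O : Set (ℙ K V)) : Prop :=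
  (∀ P ∈ O, S P.submodule) ∧
    ∀ W : Submodule K V, IsGenerator S W → {P ∈ O | P.submodule ≤ W}.encard ≤ m

/-- The binomial coefficient with integer lower index, zero if that index is negative. -/
def binom (a : ℕ) (k : ℤ) : ℤ :=
  if 0 ≤ k then (a.choose k.toNat : ℤ) else 0

end PolarSpace

/-! Three pairwise orthogonal points span an element of the polar space, hence lie in a common
generator, so a partial 2-ovoid contains no such triple. Consequently, for a point P of the set, the
other points of the set orthogonal to P become pairwise non-orthogonal singular points of the
quotient of the perp of P by P, of dimension n - 2. The proof bounds the number of these neighbours,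
and then the size of any set in which every point has few neighbours.

The first bound is a p-rank argument. If x_1, ..., x_k are pairwise non-orthogonal singular vectors,
the matrix of (|K| - 1)-th powers of B(x_i, x_j) is J - I, of rank at least k - 1. Since q - 1 = (p
- 1)(1 + p + ... + p^(h-1)) and Frobenius is additive, its rank is at most s^h, where s is the
dimension of the space of functions on the points containing the (p - 1)-th powers of the forms
B(x_i, ·). In the Hermitian case B^(q+1), the product of B and its conjugate, takes the place of B.
For s one counts monomials, and subtracts the multiples of the equation of the quadric or Hermitian
variety. So there are at most m + 1 neighbours, m being the h-th power in the theorem.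

The second bound is a ratio bound: a set of points in which each is orthogonal to at most d others
has at most E + 1 + |K| d elements, where E + 1 is the bound for d = 0. It follows from the
Cauchy–Schwarz inequality and counts of common neighbours (`card_le_of_card_perp_le`). Taking d = m
+ 1 gives the theorem (`ncard_le_of_isPartialOvoid`). The three kinds of forms are treated together
through `IsPolarForm`. -/

namespace PolarSpace

open Module

/-! ### The rank of J - I and dimensions of spaces of polynomial functions -/

section PRank

open MvPolynomial

variable {K : Type*} [Field K]

/-- If the `(1 + p + ⋯ + p ^ (h - 1))`-th powers of functions from a space of dimension at most `s`
form the matrix `J - I`, then that matrix has size at most `s ^ h + 1`. -/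
theorem card_le_of_pow_eq_ite {p : ℕ} [ExpChar K p] {h s : ℕ} {ι : Type*} [Fintype ι]
    [DecidableEq ι] (D : Submodule K (ι → K)) (hD : finrank K D ≤ s) (g : ι → ι → K)
    (hgD : ∀ i, g i ∈ D)
    (hg : ∀ i j, g i j ^ (∑ l ∈ Finset.range h, p ^ l) = if i = j then 0 else 1) :
    Fintype.card ι ≤ s ^ h + 1 := by
  classical
  set b := Module.finBasis K D with hb
  -- There is one generator for each choice of a basis function for each of the h Frobenius twists,
  -- hence at most s ^ h of them.
  set E : Submodule K (ι → K) := Submodule.span K (Set.range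
    (fun c : Fin h → Fin (finrank K D) => fun j => ∏ l, (b (c l) : ι → K) j ^ p ^ (l : ℕ))) with hE
  have hEr : finrank K E ≤ s ^ h := by
    refine (finrank_range_le_card (R := K) _).trans ?_
    simpa using Nat.pow_le_pow_left hD h
  have hmem : ∀ i, (fun j => g i j ^ (∑ l ∈ Finset.range h, p ^ l)) ∈ E := by
    intro i
    have hrep : ∀ j, g i j = ∑ c, b.repr ⟨g i, hgD i⟩ c * (b c : ι → K) j := by
      intro j
      have := congrArg (fun x : D => (x : ι → K) j) (b.sum_repr ⟨g i, hgD i⟩)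
      refine this.symm.trans ?_
      simp only [AddSubmonoidClass.coe_finsetSum, Submodule.coe_smul, Finset.sum_apply,
        Pi.smul_apply, smul_eq_mul]
    -- The power is the product over l of the p ^ l-th powers. Each of these is additive in g, so
    -- the product expands over choice functions c.
    have : (fun j => g i j ^ (∑ l ∈ Finset.range h, p ^ l)) =
        ∑ c : Fin h → Fin (finrank K D), (∏ l, b.repr ⟨g i, hgD i⟩ (c l) ^ p ^ (l : ℕ)) •
          fun j => ∏ l, (b (c l) : ι → K) j ^ p ^ (l : ℕ) := by
      funext j
      rw [← Finset.prod_pow_eq_pow_sum, ← Fin.prod_univ_eq_prod_range (fun l => g i j ^ p ^ l)]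
      simp_rw [hrep j, sum_pow_char_pow, Finset.prod_univ_sum, Finset.sum_apply, Pi.smul_apply,
        smul_eq_mul, ← Finset.prod_mul_distrib, mul_pow, Fintype.piFinset_univ]
    rw [this]
    exact Submodule.sum_mem _ fun c _ => Submodule.smul_mem _ _ (Submodule.subset_span ⟨c, rfl⟩)
  -- The all-one vector minus a row of J - I is a standard basis vector.
  have htop : E ⊔ Submodule.span K {(1 : ι → K)} = ⊤ := by
    rw [eq_top_iff, ← (Pi.basisFun K ι).span_eq, Submodule.span_le]
    rintro _ ⟨i, rfl⟩
    have h1 : Pi.basisFun K ι i =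
        (1 : ι → K) - fun j => g i j ^ (∑ l ∈ Finset.range h, p ^ l) := by
      funext j
      by_cases hij : i = j
      · subst hij; simp [hg]
      · simp [hg, hij, Ne.symm hij]
    rw [h1]
    exact Submodule.sub_mem _ (Submodule.mem_sup_right (Submodule.mem_span_singleton_self _))
      (Submodule.mem_sup_left (hmem i))
  calc Fintype.card ι = finrank K (⊤ : Submodule K (ι → K)) := by simp
    _ ≤ finrank K E + finrank K (Submodule.span K {(1 : ι → K)}) := by
      rw [← htop]; exact Submodule.finrank_add_le_finrank_add_finrank _ _
    _ ≤ s ^ h + 1 := by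
      gcongr
      exact (finrank_span_le_card _).trans (by simp)

variable {τ M : Type*} [AddCommMonoid M]

theorem finrank_weightedHomogeneousSubmodule (w : τ → M) (m : M) :
    finrank K (weightedHomogeneousSubmodule K w m) =
      Nat.card {d : τ →₀ ℕ // Finsupp.weight w d = m} := by
  rw [weightedHomogeneousSubmodule_eq_finsupp_supported]
  exact finrank_eq_nat_card_basis (basisRestrictSupport K {d | Finsupp.weight w d = m})

theorem finite_weightedHomogeneousSubmodule (w : τ → M) (m : M)
    [hfin : Finite {d : τ →₀ ℕ // Finsupp.weight w d = m}] :
    Module.Finite K (weightedHomogeneousSubmodule K w m) := by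
  rw [weightedHomogeneousSubmodule_eq_finsupp_supported]
  have : Finite ↑{d : τ →₀ ℕ | Finsupp.weight w d = m} := hfin
  exact Module.Finite.of_basis (basisRestrictSupport K {d | Finsupp.weight w d = m})

/-- Evaluation of weighted homogeneous polynomials of degree `m` at a family of points. -/
noncomputable def evalAt {ι : Type*} (w : τ → M) (m : M) (y : ι → τ → K) :
    weightedHomogeneousSubmodule K w m →ₗ[K] ι → K :=
  (LinearMap.pi fun j => (aeval (y j)).toLinearMap).comp (Submodule.subtype _)

theorem evalAt_apply {ι : Type*} (w : τ → M) (m : M) (y : ι → τ → K)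
    (f : weightedHomogeneousSubmodule K w m) (j : ι) :
    evalAt w m y f j = eval (y j) (f : MvPolynomial τ K) := by
  simp [evalAt, aeval_eq_eval]

/-- Polynomials of degree `m` whose powers have the values of the matrix `J - I` at the
points `y`. -/
theorem card_le_of_eval_pow_eq_ite {p : ℕ} [ExpChar K p] {h N : ℕ} {ι : Type*} [Fintype ι]
    [DecidableEq ι] (w : τ → M) (m : M) (y : ι → τ → K)
    (hN : finrank K (evalAt w m y).range ≤ N) (G : ι → MvPolynomial τ K)
    (hG : ∀ i, IsWeightedHomogeneous w (G i) m)
    (hpow : ∀ i j, eval (y j) (G i) ^ (∑ l ∈ Finset.range h, p ^ l) = if i = j then 0 else 1) :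
    Fintype.card ι ≤ N ^ h + 1 :=
  card_le_of_pow_eq_ite (p := p) _ hN (fun i j => eval (y j) (G i))
    (fun i => ⟨⟨G i, hG i⟩, funext fun j => evalAt_apply w m y ⟨G i, hG i⟩ j⟩) hpow

theorem finrank_range_evalAt_le {ι : Type*} [Finite ι] (w : τ → M) (m : M) (y : ι → τ → K)
    [Finite {d : τ →₀ ℕ // Finsupp.weight w d = m}] :
    finrank K (evalAt w m y).range ≤ Nat.card {d : τ →₀ ℕ // Finsupp.weight w d = m} := by
  rw [← finrank_weightedHomogeneousSubmodule (K := K)]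
  have := finite_weightedHomogeneousSubmodule (K := K) w m
  exact LinearMap.finrank_range_le _

/-- Restricted to the zeros of a weighted homogeneous polynomial `F`, the multiples of `F`
vanish. -/
theorem finrank_range_evalAt_le_sub {ι : Type*} [Finite ι] (w : τ → M) {m m₀ m' : M}
    (hm : m = m₀ + m') (y : ι → τ → K)
    [Finite {d : τ →₀ ℕ // Finsupp.weight w d = m}]
    {F : MvPolynomial τ K} (hF : IsWeightedHomogeneous w F m₀) (hF0 : F ≠ 0)
    (hFy : ∀ j, eval (y j) F = 0) :
    finrank K (evalAt w m y).range ≤ Nat.card {d : τ →₀ ℕ // Finsupp.weight w d = m} -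
      Nat.card {d : τ →₀ ℕ // Finsupp.weight w d = m'} := by
  have := finite_weightedHomogeneousSubmodule (K := K) w m
  have hmul : ∀ f : weightedHomogeneousSubmodule K w m',
      F * (f : MvPolynomial τ K) ∈ weightedHomogeneousSubmodule K w m := by
    intro f
    rw [hm]
    exact hF.mul f.2
  -- Multiplication by F is injective because polynomials form a domain, so the kernel of evaluation
  -- is at least as large as the space of weight m'.
  let L : weightedHomogeneousSubmodule K w m' →ₗ[K] (evalAt w m y).ker :=
    { toFun := fun f => ⟨⟨F * f, hmul f⟩, by
        rw [LinearMap.mem_ker]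
        funext j
        simp [evalAt_apply, hFy]⟩
      map_add' := fun f g => by ext1; ext1; simp [mul_add]
      map_smul' := fun a f => by ext1; ext1; simp }
  have hL : Function.Injective L := by
    intro f g hfg
    have : F * (f : MvPolynomial τ K) = F * (g : MvPolynomial τ K) :=
      congrArg (fun x : (evalAt w m y).ker => (x.1 : MvPolynomial τ K)) hfg
    exact Subtype.ext (mul_left_cancel₀ hF0 this)
  have h1 := LinearMap.finrank_le_finrank_of_injective hL
  have h2 := (evalAt w m y).finrank_range_add_finrank_ker
  rw [finrank_weightedHomogeneousSubmodule] at h1 h2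
  omega

theorem card_weight_one (n d : ℕ) :
    Nat.card {s : Fin n →₀ ℕ // Finsupp.weight (1 : Fin n → ℕ) s = d} = (n + d - 1).choose d := by
  have h := Finset.card_finsuppAntidiag_nat_eq_choose (s := (Finset.univ : Finset (Fin n))) d
  rw [Finset.card_univ, Fintype.card_fin] at h
  rw [← h, ← Nat.card_eq_finsetCard]
  refine Nat.card_congr (Equiv.subtypeEquivRight fun s => ?_)
  simp [Finset.mem_finsuppAntidiag, Finsupp.weight_eq_sum]

/-- The weight that counts the degrees in the two halves of the variables separately. -/
def biweight (n : ℕ) : Fin n ⊕ Fin n → ℕ × ℕ :=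
  Sum.elim (fun _ => (1, 0)) (fun _ => (0, 1))

theorem card_biweight (n d : ℕ) :
    Nat.card {s : Fin n ⊕ Fin n →₀ ℕ // Finsupp.weight (biweight n) s = (d, d)} =
      (n + d - 1).choose d ^ 2 := by
  rw [sq, ← card_weight_one, ← Nat.card_prod]
  refine Nat.card_congr ((Equiv.subtypeEquiv Finsupp.sumFinsuppEquivProdFinsupp fun s => ?_).trans
    (Equiv.subtypeProdEquivProd))
  rw [Finsupp.weight_eq_sum, Finsupp.weight_eq_sum, Finsupp.weight_eq_sum]
  simp [biweight, Prod.ext_iff, Prod.fst_sum, Prod.snd_sum]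

end PRank

/-! ### p-rank bounds for pairwise non-orthogonal vectors -/

section PartialOvoidBounds

open MvPolynomial

variable {K V τ M : Type*} [Field K] [AddCommGroup V] [Module K V] [AddCommMonoid M]

theorem pred_mul_geom_sum_eq (p h : ℕ) (hp : 0 < p) :
    (p - 1) * ∑ l ∈ Finset.range h, p ^ l = p ^ h - 1 := by
  zify [Nat.one_le_pow h p hp, hp]
  rw [mul_comm, geom_sum_mul]

theorem finite_weight_one {n d : ℕ} :
    Finite {s : Fin n →₀ ℕ // Finsupp.weight (1 : Fin n → ℕ) s = d} :=
  Finsupp.finite_of_nat_weight_eq _ (by simp) d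

theorem finite_biweight {n d : ℕ} :
    Finite {s : Fin n ⊕ Fin n →₀ ℕ // Finsupp.weight (biweight n) s = (d, d)} := by
  refine Set.Finite.subset (Finsupp.finite_of_degree_le (2 * d)) fun s hs => ?_
  have hs' : Finsupp.weight (biweight n) s = (d, d) := hs
  rw [Finsupp.weight_eq_sum] at hs'
  simp only [biweight, Fintype.sum_sum_type, Sum.elim_inl, Sum.elim_inr, Prod.ext_iff,
    Prod.fst_add, Prod.snd_add, Prod.fst_sum, Prod.snd_sum, Prod.smul_fst, Prod.smul_snd,
    smul_eq_mul, mul_one, mul_zero, Finset.sum_const_zero, add_zero, zero_add] at hs'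
  simp only [Set.mem_ofPred_eq, Finsupp.degree_eq_sum, Fintype.sum_sum_type]
  omega

/-- The linear form with coefficients `a` in the variables `v c`. -/
noncomputable def linForm {n : ℕ} (v : Fin n → τ) (a : Fin n → K) : MvPolynomial τ K :=
  ∑ c, C (a c) * X (v c)

theorem isWeightedHomogeneous_linForm {n : ℕ} {w : τ → M} {m : M} {v : Fin n → τ}
    (hv : ∀ c, w (v c) = m) (a : Fin n → K) : IsWeightedHomogeneous w (linForm v a) m :=
  IsWeightedHomogeneous.sum _ _ _ fun c _ => by
    simpa [hv] using (isWeightedHomogeneous_X K w (v c)).C_mul (a c)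

theorem eval_linForm {n : ℕ} (v : Fin n → τ) (a : Fin n → K) (y : τ → K) :
    eval y (linForm v a) = ∑ c, a c * y (v c) := by
  simp [linForm]

/-- The polynomial of a sesquilinear form in two groups of variables. -/
noncomputable def formPoly {n : ℕ} (v v' : Fin n → τ) (a : Fin n → Fin n → K) : MvPolynomial τ K :=
  ∑ c, X (v c) * linForm v' (a c)

theorem isWeightedHomogeneous_formPoly {n : ℕ} {w : τ → M} {m m' : M} {v v' : Fin n → τ}
    (hv : ∀ c, w (v c) = m) (hv' : ∀ c, w (v' c) = m') (a : Fin n → Fin n → K) :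
    IsWeightedHomogeneous w (formPoly v v' a) (m + m') :=
  IsWeightedHomogeneous.sum _ _ _ fun c _ => by
    simpa [hv] using (isWeightedHomogeneous_X K w (v c)).mul
      (isWeightedHomogeneous_linForm hv' (a c))

theorem eval_formPoly {n : ℕ} (v v' : Fin n → τ) (a : Fin n → Fin n → K) (y : τ → K) :
    eval y (formPoly v v' a) = ∑ c, y (v c) * ∑ c', a c c' * y (v' c') := by
  simp [formPoly, eval_linForm]

theorem apply_sum_smul {σ : K →+* K} (B : V →ₛₗ[σ] V →ₗ[K] K) {n : ℕ} (e : Fin n → V)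
    (y z : Fin n → K) :
    B (∑ c, y c • e c) (∑ c, z c • e c) = ∑ c, σ (y c) * ∑ c', B (e c) (e c') * z c' := by
  simp only [map_sum, LinearMap.map_smulₛₗ, LinearMap.sum_apply, LinearMap.smul_apply, smul_eq_mul,
    RingHom.id_apply, Finset.mul_sum]
  rw [Finset.sum_comm]
  exact Finset.sum_congr rfl fun c _ => Finset.sum_congr rfl fun c' _ => by ring

/-- Sets with at most one element satisfy the bound trivially, so two distinct members may be
assumed. In the applications these are non-orthogonal vectors, which show that the polynomial of the
form is nonzero. -/
theorem card_le_of_pairs {α : Type*} {s : Finset α} {N : ℕ}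
    (h : ∀ x ∈ s, ∀ y ∈ s, x ≠ y → s.card ≤ N + 1) : s.card ≤ N + 1 := by
  rcases Nat.lt_or_ge 1 s.card with hs | hs
  · obtain ⟨x, hx, y, hy, hxy⟩ := Finset.one_lt_card.1 hs
    exact h x hx y hy hxy
  · omega

variable {p h : ℕ} [Fact p.Prime] {n : ℕ} {e : Fin n → V} {s : Finset V}

theorem charP_of_natCard (hK : Nat.card K = p ^ h) : CharP K p := by
  have hfin : Finite K := Nat.finite_of_card_ne_zero (by
    rw [hK]; exact pow_ne_zero _ (Fact.out : p.Prime).ne_zero)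
  have := Fintype.ofFinite K
  rw [Nat.card_eq_fintype_card] at hK
  exact charP_of_card_eq_prime_pow hK

theorem pow_natCard_sub_one {k : ℕ} (hk : 1 < k) (hK : Nat.card K = k) [DecidableEq K] (a : K) :
    a ^ (k - 1) = if a = 0 then 0 else 1 := by
  have hfin : Finite K := Nat.finite_of_card_ne_zero (by omega)
  have := Fintype.ofFinite K
  rw [Nat.card_eq_fintype_card] at hK
  split_ifs with ha
  · rw [ha, zero_pow (by omega)]
  · rw [← hK]; exact FiniteField.pow_card_sub_one_eq_one a ha

/-- Vectors in a space of dimension `n` that are pairwise non-orthogonal but isotropic. -/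
theorem card_le_symplectic (h0 : h ≠ 0) (hK : Nat.card K = p ^ h) (f : V → V →ₗ[K] K)
    (hs : ∀ x ∈ s, x ∈ Submodule.span K (Set.range e))
    (hf : ∀ x ∈ s, ∀ y ∈ s, f x y = 0 ↔ x = y) :
    s.card ≤ (n + (p - 1) - 1).choose (p - 1) ^ h + 1 := by
  classical
  have hp : p.Prime := Fact.out
  have := charP_of_natCard hK
  have := finite_weight_one (n := n) (d := p - 1)
  choose y hy using fun x : s => (Submodule.mem_span_range_iff_exists_fun K).1 (hs x x.2)
  rw [← Fintype.card_coe s, ← card_weight_one]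
  refine card_le_of_eval_pow_eq_ite (p := p) (1 : Fin n → ℕ) (p - 1) y
    (finrank_range_evalAt_le (1 : Fin n → ℕ) (p - 1) y)
    (fun i => linForm id (fun c => f i (e c)) ^ (p - 1)) (fun i => ?_) ?_
  · have hl := (isWeightedHomogeneous_linForm (w := (1 : Fin n → ℕ)) (m := 1) (v := id)
      (fun _ => rfl) (fun c => f i (e c))).pow (p - 1)
    rwa [smul_eq_mul, mul_one] at hl
  · intro i j
    have hij : eval (y j) (linForm id fun c => f i (e c)) = f i j := by
      rw [eval_linForm]
      conv_rhs => rw [← hy j, map_sum]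
      simp only [map_smul, smul_eq_mul, id, mul_comm]
    rw [map_pow, hij, ← pow_mul, pred_mul_geom_sum_eq p h hp.pos,
      pow_natCard_sub_one (Nat.one_lt_pow h0 hp.one_lt) hK]
    simp [hf i i.2 j j.2]

/-- Singular vectors in a space of dimension `n` that are pairwise non-orthogonal. -/
theorem card_le_quadric (h0 : h ≠ 0) (hK : Nat.card K = p ^ h) (hp3 : 3 ≤ p) (Q : QuadraticForm K V)
    (hs : ∀ x ∈ s, x ∈ Submodule.span K (Set.range e)) (hQ : ∀ x ∈ s, Q x = 0)
    (hf : ∀ x ∈ s, ∀ y ∈ s, x ≠ y → Q.polarBilin x y ≠ 0) :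
    s.card ≤ ((n + (p - 1) - 1).choose (p - 1) - (n + (p - 3) - 1).choose (p - 3)) ^ h + 1 := by
  classical
  refine card_le_of_pairs fun x₁ hx₁ x₂ hx₂ hx => ?_
  have hf' : ∀ x ∈ s, ∀ y ∈ s, Q.polarBilin x y = 0 ↔ x = y := fun x hx y hy => by
    refine ⟨fun h => by_contra fun hxy => hf x hx y hy hxy h, fun h => ?_⟩
    subst h
    simp [hQ x hx]
  have hp : p.Prime := Fact.out
  have := charP_of_natCard hK
  have := finite_weight_one (n := n) (d := p - 1)
  choose y hy using fun x : s => (Submodule.mem_span_range_iff_exists_fun K).1 (hs x x.2)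
  obtain ⟨B, hB⟩ := LinearMap.BilinMap.toQuadraticMap_surjective Q
  set F : MvPolynomial (Fin n) K := formPoly id id fun c c' => B (e c) (e c') with hFdef
  have hFeval : ∀ z : Fin n → K, eval z F = Q (∑ c, z c • e c) := fun z => by
    rw [hFdef, eval_formPoly, ← hB, LinearMap.BilinMap.toQuadraticMap_apply,
      apply_sum_smul (σ := RingHom.id K)]
    rfl
  have hF : IsWeightedHomogeneous (1 : Fin n → ℕ) F 2 :=
    isWeightedHomogeneous_formPoly (m := 1) (m' := 1) (by simp) (by simp) _
  -- Otherwise Q vanishes at x₁ + x₂; as x₁ and x₂ are singular, they would be orthogonal.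
  have hF0 : F ≠ 0 := by
    intro h0
    have := hFeval (y ⟨x₁, hx₁⟩ + y ⟨x₂, hx₂⟩)
    simp only [h0, map_zero, Pi.add_apply, add_smul, Finset.sum_add_distrib, hy] at this
    apply hf x₁ hx₁ x₂ hx₂ hx
    simp [QuadraticMap.polar, ← this, hQ x₁ hx₁, hQ x₂ hx₂]
  rw [← Fintype.card_coe s, ← card_weight_one, ← card_weight_one]
  refine card_le_of_eval_pow_eq_ite (p := p) (1 : Fin n → ℕ) (p - 1) y
    (finrank_range_evalAt_le_sub (1 : Fin n → ℕ) (show p - 1 = 2 + (p - 3) by omega) y hF hF0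
      fun j => by rw [hFeval, hy, hQ j j.2])
    (fun i => linForm id (fun c => Q.polarBilin i (e c)) ^ (p - 1)) (fun i => ?_) ?_
  · have hl := (isWeightedHomogeneous_linForm (w := (1 : Fin n → ℕ)) (m := 1) (v := id)
      (fun _ => rfl) (fun c => Q.polarBilin i (e c))).pow (p - 1)
    rwa [smul_eq_mul, mul_one] at hl
  · intro i j
    have hij : eval (y j) (linForm id fun c => Q.polarBilin i (e c)) = Q.polarBilin i j := by
      rw [eval_linForm]
      conv_rhs => rw [← hy j, map_sum]
      simp only [map_smul, smul_eq_mul, id, mul_comm]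
    rw [map_pow, hij, ← pow_mul, pred_mul_geom_sum_eq p h hp.pos,
      pow_natCard_sub_one (Nat.one_lt_pow h0 hp.one_lt) hK]
    simp only [hf' i i.2 j j.2, Subtype.ext_iff]

/-- Isotropic vectors of a Hermitian form in a space of dimension `n` that are pairwise
non-orthogonal. -/
theorem card_le_hermitian (h0 : h ≠ 0) (hK : Nat.card K = (p ^ h) ^ 2) {σ : K →+* K}
    (hσ : ∀ x, σ x = x ^ p ^ h) (B : V →ₛₗ[σ] V →ₗ[K] K)
    (hs : ∀ x ∈ s, x ∈ Submodule.span K (Set.range e)) (hQ : ∀ x ∈ s, B x x = 0)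
    (hf : ∀ x ∈ s, ∀ y ∈ s, x ≠ y → B x y ≠ 0) :
    s.card ≤ ((n + (p - 1) - 1).choose (p - 1) ^ 2 - (n + (p - 2) - 1).choose (p - 2) ^ 2) ^ h
      + 1 := by
  classical
  refine card_le_of_pairs fun x₁ hx₁ x₂ hx₂ hx => ?_
  have hf' : ∀ x ∈ s, ∀ y ∈ s, B x y = 0 ↔ x = y := fun x hx y hy => by
    refine ⟨fun h => by_contra fun hxy => hf x hx y hy hxy h, fun h => ?_⟩
    subst h
    exact hQ x hx
  have hp : p.Prime := Fact.out
  have hp2 := hp.two_le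
  have hph : 1 < p ^ h := Nat.one_lt_pow h0 hp.one_lt
  have := charP_of_natCard (K := K) (p := p) (h := h * 2) (by rw [hK, pow_mul])
  have := finite_biweight (n := n) (d := p - 1)
  choose y hy using fun x : s => (Submodule.mem_span_range_iff_exists_fun K).1 (hs x x.2)
  set F : MvPolynomial (Fin n ⊕ Fin n) K :=
    formPoly Sum.inr Sum.inl fun c c' => B (e c) (e c') with hFdef
  have hFeval : ∀ z z' : Fin n → K, eval (Sum.elim z (fun c => σ (z' c))) F =
      B (∑ c, z' c • e c) (∑ c, z c • e c) := fun z z' => by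
    rw [hFdef, eval_formPoly, apply_sum_smul]
    rfl
  have hF : IsWeightedHomogeneous (biweight n) F (1, 1) := by
    have hl := isWeightedHomogeneous_formPoly (w := biweight n) (m := (0, 1)) (m' := (1, 0))
      (v := Sum.inr) (v' := Sum.inl) (fun _ => rfl) (fun _ => rfl) fun c c' => B (e c) (e c')
    rwa [Prod.mk_add_mk, zero_add] at hl
  have hF0 : F ≠ 0 := by
    intro h0
    have := hFeval (y ⟨x₂, hx₂⟩) (y ⟨x₁, hx₁⟩)
    rw [h0, map_zero, hy, hy] at this
    exact hf x₁ hx₁ x₂ hx₂ hx this.symm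
  rw [← Fintype.card_coe s, ← card_biweight, ← card_biweight]
  refine card_le_of_eval_pow_eq_ite (p := p) (biweight n) (p - 1, p - 1)
    -- The coordinates and their conjugates are treated as independent variables; the form then has
    -- bidegree (1, 1).
    (fun j => Sum.elim (y j) (fun c => σ (y j c)))
    (finrank_range_evalAt_le_sub (biweight n) (m₀ := (1, 1)) (m' := (p - 2, p - 2)) ?_ _ hF hF0
      fun j => by rw [hFeval, hy, hQ j j.2])
    -- At the j-th point this is the (p - 1)-th power of B i j times its conjugate, that is of (B i
    -- j)^(q+1) with q = p ^ h. The remaining exponent raises it to (q + 1)(q - 1) = |K| - 1.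
    (fun i => linForm Sum.inl (fun c => B i (e c)) ^ (p - 1) *
      linForm Sum.inr (fun c => σ (B i (e c))) ^ (p - 1)) (fun i => ?_) ?_
  · rw [Prod.mk_add_mk, Prod.mk.injEq]
    omega
  · have hl := ((isWeightedHomogeneous_linForm (w := biweight n) (m := (1, 0)) (v := Sum.inl)
      (fun _ => rfl) (fun c => B i (e c))).pow (p - 1)).mul
      ((isWeightedHomogeneous_linForm (w := biweight n) (m := (0, 1)) (v := Sum.inr)
      (fun _ => rfl) (fun c => σ (B i (e c)))).pow (p - 1))
    simpa only [Prod.smul_mk, smul_eq_mul, mul_one, mul_zero, Prod.mk_add_mk, add_zero,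
      zero_add] using hl
  · intro i j
    have hij : B i j = ∑ c, B i (e c) * y j c := by
      conv_lhs => rw [← hy j, map_sum]
      simp only [map_smul, smul_eq_mul, mul_comm]
    have hij' : ∑ c, σ (B i (e c)) * σ (y j c) = σ (B i j) := by
      rw [hij, map_sum]
      simp only [map_mul]
    have hexp : (p ^ h + 1) * (p ^ h - 1) = (p ^ h) ^ 2 - 1 := by
      have := Nat.sq_sub_sq (p ^ h) 1
      simpa using this.symm
    rw [map_mul, map_pow, map_pow, eval_linForm, eval_linForm]
    simp only [Sum.elim_inl, Sum.elim_inr]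
    rw [← hij, hij', ← mul_pow, ← pow_mul, pred_mul_geom_sum_eq p h hp.pos, hσ, ← pow_succ',
      ← pow_mul, hexp, pow_natCard_sub_one (Nat.one_lt_pow (by norm_num) hph) hK]
    simp only [hf' i i.2 j j.2, Subtype.ext_iff]

end PartialOvoidBounds

/-! ### Polar forms, generators and counting by translation -/

section Counting

variable {K V : Type*} [Field K] [AddCommGroup V] [Module K V]

/-- A sesquilinear form `B` together with a set `Z` of singular vectors, with the properties common
to alternating, quadratic and Hermitian forms: a line through a singular vector `x`, not orthogonal
to `x`, has a constant number `t` of singular vectors other than those in the direction of `x`. -/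
structure IsPolarForm {σ : K →+* K} (B : V →ₛₗ[σ] V →ₗ[K] K) (Z : Set V) (t : ℕ) : Prop where
  refl : ∀ x y, B x y = 0 → B y x = 0
  smul_mem : ∀ (a : K), ∀ x ∈ Z, a • x ∈ Z
  add_mem : ∀ x ∈ Z, ∀ y ∈ Z, B x y = 0 → x + y ∈ Z
  apply_self : ∀ x ∈ Z, B x x = 0
  apply_ne_zero : ∀ x ∈ Z, x ≠ 0 → B x ≠ 0
  card_line : ∀ x ∈ Z, ∀ v, B x v ≠ 0 → Nat.card {a : K // v + a • x ∈ Z} = t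

/-- The subspaces of the polar space of `B` and `Z`. -/
def IsElement {σ : K →+* K} (B : V →ₛₗ[σ] V →ₗ[K] K) (Z : Set V) (W : Submodule K V) : Prop :=
  (∀ x ∈ W, x ∈ Z) ∧ TotallyIsotropic B W

open scoped Classical

/-- A set of vectors that is invariant under translations along `w` meets the kernel of a functional
not vanishing at `w` in a fraction `1 / |K|` of its elements. -/
theorem card_mul_card_filter_apply_eq_zero [Fintype K] (A : Finset V) (w : V)
    (hA : ∀ v ∈ A, ∀ a : K, v + a • w ∈ A) (f : V →ₗ[K] K) (hf : f w ≠ 0) :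
    Fintype.card K * (A.filter fun v => f v = 0).card = A.card := by
  rw [← Finset.card_univ, ← Finset.card_product]
  refine Finset.card_nbij' (fun av => av.2 + av.1 • w)
    (fun v => (f v / f w, v + (-(f v / f w)) • w)) ?_ ?_ ?_ ?_
  · intro av h
    simp only [Finset.coe_product, Finset.coe_filter, Set.mem_prod, Set.mem_ofPred_eq] at h
    exact hA _ h.2.1 _
  · intro v h
    simp only [Finset.coe_product, Finset.coe_filter, Set.mem_prod, Set.mem_ofPred_eq,
      Finset.coe_univ, Set.mem_univ, true_and]
    refine ⟨hA _ h _, ?_⟩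
    rw [map_add, map_smul, smul_eq_mul]
    field_simp
    ring
  · rintro ⟨a, v⟩ h
    simp only [Finset.coe_product, Finset.coe_filter, Set.mem_prod, Set.mem_ofPred_eq] at h
    have : f (v + a • w) / f w = a := by
      rw [map_add, h.2.2, map_smul, smul_eq_mul, zero_add, mul_div_cancel_right₀ _ hf]
    simp only [this, Prod.mk.injEq, true_and]
    module
  · intro v _
    dsimp only
    module

variable {σ : K →+* K} {B : V →ₛₗ[σ] V →ₗ[K] K} {Z : Set V} {t : ℕ}

namespace IsPolarForm

theorem perp_comm (hB : IsPolarForm B Z t) (x y : V) : B x y = 0 ↔ B y x = 0 :=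
  ⟨hB.refl x y, hB.refl y x⟩

theorem exists_not_perp (hB : IsPolarForm B Z t) {x : V} (hx : x ∈ Z) (hx0 : x ≠ 0) :
    ∃ v, B x v ≠ 0 := by
  by_contra! h
  exact hB.apply_ne_zero x hx hx0 (LinearMap.ext h)

theorem isElement_sup_span (hB : IsPolarForm B Z t) {W : Submodule K V} (hW : IsElement B Z W)
    {v : V} (hv : v ∈ Z) (hvW : ∀ w ∈ W, B v w = 0) :
    IsElement B Z (W ⊔ Submodule.span K {v}) := by
  constructor
  · intro x hx
    obtain ⟨w, hw, _, hx', rfl⟩ := Submodule.mem_sup.1 hx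
    obtain ⟨a, rfl⟩ := Submodule.mem_span_singleton.1 hx'
    refine hB.add_mem _ (hW.1 w hw) _ (hB.smul_mem _ _ hv) ?_
    rw [map_smul, hB.refl _ _ (hvW w hw), smul_zero]
  · intro x hx y hy
    obtain ⟨w, hw, _, hx', rfl⟩ := Submodule.mem_sup.1 hx
    obtain ⟨a, rfl⟩ := Submodule.mem_span_singleton.1 hx'
    obtain ⟨w', hw', _, hy', rfl⟩ := Submodule.mem_sup.1 hy
    obtain ⟨a', rfl⟩ := Submodule.mem_span_singleton.1 hy'
    simp [hW.2 w hw w' hw', hvW w' hw', hB.refl _ _ (hvW w hw), hB.apply_self v hv]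

variable [FiniteDimensional K V]

theorem finrank_ker_add_one (hB : IsPolarForm B Z t) {x : V} (hx : x ∈ Z) (hx0 : x ≠ 0) :
    finrank K (B x).ker + 1 = finrank K V :=
  Module.Dual.finrank_ker_add_one_of_ne_zero (f := B x) (hB.apply_ne_zero x hx hx0)

theorem finrank_lt_finrank_sup_span {W : Submodule K V} {v : V} (hv : v ∉ W) :
    finrank K W < finrank K (W ⊔ Submodule.span K {v} : Submodule K V) := by
  refine Submodule.finrank_lt_finrank_of_lt (lt_of_le_of_ne le_sup_left fun h => hv ?_)
  rw [h]
  exact Submodule.mem_sup_right (Submodule.mem_span_singleton_self v)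

/-- An element of smaller dimension than another one can be extended by a vector of the latter. -/
theorem exists_mem_perp (hB : IsPolarForm B Z t) {G U : Submodule K V} (hU : IsElement B Z U)
    (hlt : finrank K G < finrank K U) : ∃ u ∈ U, u ∉ G ∧ ∀ g ∈ G, B u g = 0 := by
  obtain ⟨G', hG'⟩ := Submodule.exists_isCompl (Submodule.comap G.subtype U)
  have hfr := Submodule.finrank_add_eq_of_isCompl hG'
  -- U is totally isotropic, so a vector of U is orthogonal to G once it is orthogonal to the
  -- complement G' of U ∩ G in G. These are dim G' conditions, whose solution space in U has
  -- dimension at least dim U - dim G + dim (U ∩ G), too large to lie in U ∩ G.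
  have hcom : finrank K (Submodule.comap G.subtype U) = finrank K (U ⊓ G : Submodule K V) := by
    rw [← Submodule.finrank_map_subtype_eq G (Submodule.comap G.subtype U),
      Submodule.map_comap_subtype, inf_comm]
  let b := Module.finBasis K G'
  let φ : U →ₗ[K] (Fin (finrank K G') → K) :=
    LinearMap.pi fun i => (B (b i : G)).comp U.subtype
  have hker := φ.finrank_range_add_finrank_ker
  have hran : finrank K φ.range ≤ finrank K G' := by
    simpa using Submodule.finrank_le φ.range
  by_contra! hcon
  have hperp : ∀ u ∈ φ.ker, ∀ g ∈ G, B (u : V) g = 0 := by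
    intro u hu g hg
    have hg' : (⟨g, hg⟩ : G) ∈ Submodule.comap G.subtype U ⊔ G' := by
      rw [hG'.sup_eq_top]; trivial
    obtain ⟨g₁, hg₁, g₂, hg₂, hsum⟩ := Submodule.mem_sup.1 hg'
    have hg12 : g = g₁ + g₂ := by simpa using congrArg (G.subtype) hsum.symm
    have h1 : B (u : V) g₁ = 0 := hU.2 _ u.2 _ hg₁
    have h2 : B (u : V) (g₂ : V) = 0 := by
      have hle : G' ≤ ((B (u : V)).comp G.subtype).ker := by
        have hbs : Submodule.map G'.subtype ⊤ = G' := by simp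
        rw [← hbs, ← b.span_eq, Submodule.map_span, Submodule.span_le]
        rintro _ ⟨_, ⟨i, rfl⟩, rfl⟩
        exact hB.refl _ _ (congrFun hu i)
      exact hle hg₂
    rw [hg12, map_add, h1, h2, add_zero]
  have hle : Submodule.map U.subtype φ.ker ≤ U ⊓ G := by
    rintro _ ⟨u, hu, rfl⟩
    refine ⟨u.2, ?_⟩
    by_contra hG
    obtain ⟨g, hg, hne⟩ := hcon u u.2 hG
    exact hne (hperp u hu g hg)
  have hle' := Submodule.finrank_mono hle
  rw [Submodule.finrank_map_subtype_eq] at hle'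
  omega

/-- Every element of a polar space lies in a generator. -/
theorem exists_generator (hB : IsPolarForm B Z t) {W : Submodule K V} (hW : IsElement B Z W) :
    ∃ G, W ≤ G ∧ IsGenerator (IsElement B Z) G := by
  induction hd : finrank K V - finrank K W using Nat.strong_induction_on generalizing W with
  | _ d ih =>
    by_cases hgen : IsGenerator (IsElement B Z) W
    · exact ⟨W, le_rfl, hgen⟩
    · obtain ⟨U, hU, hlt⟩ : ∃ U, IsElement B Z U ∧ finrank K W < finrank K U := by
        by_contra! h
        exact hgen ⟨hW, h⟩
      obtain ⟨u, huU, huW, hperp⟩ := hB.exists_mem_perp hU hlt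
      have h1 := finrank_lt_finrank_sup_span huW
      have h2 := Submodule.finrank_le (W ⊔ Submodule.span K {u})
      obtain ⟨G, hG, hGgen⟩ := ih _ (by omega)
        (hB.isElement_sup_span hW (hU.1 u huU) hperp) rfl
      exact ⟨G, le_sup_left.trans hG, hGgen⟩

end IsPolarForm

variable [Fintype K] [Fintype V]

theorem card_filter_mem_submodule (W : Submodule K V) :
    (Finset.univ.filter fun v => v ∈ W).card = Fintype.card K ^ finrank K W := by
  rw [← Module.card_eq_pow_finrank (K := K) (V := W), Fintype.card_subtype]

theorem card_mul_card_filter_mem_and_apply_eq_zero (W : Submodule K V) (f : V →ₗ[K] K)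
    (hf : ∃ w ∈ W, f w ≠ 0) :
    Fintype.card K * (Finset.univ.filter fun v => v ∈ W ∧ f v = 0).card =
      Fintype.card K ^ finrank K W := by
  obtain ⟨w, hw, hfw⟩ := hf
  rw [← card_filter_mem_submodule, ← Finset.filter_filter]
  refine card_mul_card_filter_apply_eq_zero _ w (fun v hv a => ?_) f hfw
  simp only [Finset.mem_filter, Finset.mem_univ, true_and] at hv ⊢
  exact W.add_mem hv (W.smul_mem a hw)

namespace IsPolarForm

/-- Translations along x permute the vectors of W not orthogonal to x, and each orbit has exactly t
members in Z. Double counting pairs of a vector and a scalar gives the identity. -/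
theorem card_mul_card_not_perp (hB : IsPolarForm B Z t) {x : V} (hx : x ∈ Z) {W : Submodule K V}
    (hxW : x ∈ W) :
    Fintype.card K * (Finset.univ.filter fun v => v ∈ Z ∧ v ∈ W ∧ B x v ≠ 0).card =
      t * (Finset.univ.filter fun v => v ∈ W ∧ B x v ≠ 0).card := by
  set A := Finset.univ.filter fun v => v ∈ W ∧ B x v ≠ 0 with hA
  have hmem : ∀ v, v ∈ A ↔ v ∈ W ∧ B x v ≠ 0 := fun v => by simp [hA]
  have htr : ∀ v ∈ A, ∀ a : K, v + a • x ∈ A := fun v hv a => by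
    rw [hmem] at hv ⊢
    refine ⟨W.add_mem hv.1 (W.smul_mem a hxW), ?_⟩
    simpa [hB.apply_self x hx] using hv.2
  have h1 : ∀ v ∈ A, (Finset.univ.filter fun a : K => v + a • x ∈ Z).card = t := fun v hv => by
    rw [← hB.card_line x hx v ((hmem v).1 hv).2, Nat.card_eq_fintype_card, Fintype.card_subtype]
  have h2 : ∀ a ∈ (Finset.univ : Finset K), (A.filter fun v => v + a • x ∈ Z).card =
      (Finset.univ.filter fun v => v ∈ Z ∧ v ∈ W ∧ B x v ≠ 0).card := fun a _ => by
    refine Finset.card_nbij' (fun v => v + a • x) (fun v => v + (-a) • x) ?_ ?_ ?_ ?_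
    · intro v hv
      simp only [Finset.coe_filter, Set.mem_ofPred_eq, Finset.mem_univ, true_and] at hv ⊢
      exact ⟨hv.2, (hmem _).1 (htr v hv.1 a)⟩
    · intro v hv
      simp only [Finset.coe_filter, Set.mem_ofPred_eq, Finset.mem_univ, true_and] at hv ⊢
      refine ⟨htr v ((hmem v).2 hv.2) _, ?_⟩
      have : v + -a • x + a • x = v := by module
      rw [this]
      exact hv.1
    · intro v _
      dsimp only
      module
    · intro v _
      dsimp only
      module
  have h3 := Finset.sum_card_bipartiteAbove_eq_sum_card_bipartiteBelow
    (s := A) (t := (Finset.univ : Finset K)) (fun v a => v + a • x ∈ Z)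
  simp only [Finset.bipartiteAbove, Finset.bipartiteBelow] at h3
  rw [Finset.sum_congr rfl h1, Finset.sum_congr rfl h2, Finset.sum_const, Finset.sum_const,
    smul_eq_mul, smul_eq_mul, Finset.card_univ] at h3
  rw [← h3, mul_comm]

/-- If the perp of x were contained in that of y, then B y would be a multiple of B x, and some y -
a x would be a singular vector in the radical, hence zero. -/
theorem exists_perp_not_perp (hB : IsPolarForm B Z t) {x y : V} (hx : x ∈ Z) (hy : y ∈ Z)
    (hxy : B x y = 0) (hyx : y ∉ Submodule.span K {x}) : ∃ v ∈ (B x).ker, B y v ≠ 0 := by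
  by_contra! h
  have hle : (B x).ker ≤ (B y).ker := fun v hv => h v hv
  obtain ⟨c, hc⟩ : ∃ c : K, B y = c • B x := by
    by_cases hx0 : B x = 0
    · refine ⟨0, LinearMap.ext fun v => ?_⟩
      simpa using h v (by simp [hx0])
    · obtain ⟨w, hw⟩ : ∃ w, B x w ≠ 0 := by
        by_contra! h'
        exact hx0 (LinearMap.ext h')
      refine ⟨B y w / B x w, LinearMap.ext fun v => ?_⟩
      have := h (v + (-(B x v / B x w)) • w) (by
        rw [LinearMap.mem_ker, map_add, map_smul, smul_eq_mul]
        field_simp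
        ring)
      rw [map_add, map_smul, smul_eq_mul] at this
      rw [LinearMap.smul_apply, smul_eq_mul]
      field_simp at this ⊢
      linear_combination this
  -- Since B is semilinear on the left, the factor c has to be pulled back through σ, which is
  -- surjective on a finite field.
  obtain ⟨a, rfl⟩ : ∃ a, σ a = c := (Finite.injective_iff_surjective.1 σ.injective) c
  apply hyx
  have hz : y + (-a) • x ∈ Z := hB.add_mem _ hy _ (hB.smul_mem _ _ hx) (by
    rw [map_smul, hB.refl _ _ hxy, smul_zero])
  have h0 : y + (-a) • x = 0 := by
    by_contra h0
    refine hB.apply_ne_zero _ hz h0 ?_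
    rw [map_add, LinearMap.map_smulₛₗ, hc, map_neg]
    module
  rw [Submodule.mem_span_singleton]
  exact ⟨a, by rw [neg_smul, ← sub_eq_add_neg, sub_eq_zero] at h0; exact h0.symm⟩

end IsPolarForm

end Counting

/-! ### The ratio bound -/

section Spectral

open scoped Classical

variable {K V : Type*} [Field K] [AddCommGroup V] [Module K V] [Fintype V]

/-- The algebra behind the ratio bound for the collinearity graph of a polar space. -/
theorem le_of_ratio_inequality {q R T d u : ℝ} (hq : 1 < q) (hR : 1 ≤ R) (hT : 0 ≤ T) (hd : 0 ≤ d)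
    (hu : 0 ≤ u)
    (h : (u * ((T + 1) * (q * R - 1))) ^ 2 ≤ ((q * R - 1) * (q * T + 1)) *
      (u * u * ((R - 1) * (T + 1)) + (q - 1) * (R + T) * (u * (d + 1) + T * u))) :
    u ≤ q * T + 1 + q * d := by
  rcases hu.eq_or_lt with rfl | hu
  · positivity
  have hqR : 0 < q * R - 1 := by nlinarith
  have hpos : 0 < (q * R - 1) * u * ((q - 1) * (R + T)) := by
    have : 0 < q - 1 := by linarith
    positivity
  -- This is the sharper ratio bound; the simpler form in the conclusion loses (q - 1) * d after
  -- multiplication by T + 1.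
  have h1 : u * (T + 1) ≤ (q * T + 1) * (T + 1 + d) := by
    refine le_of_mul_le_mul_left ?_ hpos
    linear_combination h
  have h2 : (q * T + 1) * (T + 1 + d) ≤ (q * T + 1 + q * d) * (T + 1) := by
    nlinarith [mul_nonneg (sub_nonneg.2 hq.le) hd]
  exact le_of_mul_le_mul_right (h1.trans h2) (by linarith)

namespace IsPolarForm

variable {σ : K →+* K} {B : V →ₛₗ[σ] V →ₗ[K] K} {Z : Set V} {t : ℕ}

theorem card_filter_ne_zero (hB : IsPolarForm B Z t) {x : V} (hx : x ∈ Z) (P : V → Prop)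
    [DecidablePred P] (hP : P 0) :
    (((Finset.univ.filter fun v => v ∈ Z ∧ v ≠ 0).filter P).card : ℝ) =
      ((Finset.univ.filter fun v => v ∈ Z ∧ P v).card : ℝ) - 1 := by
  have h0 : (0 : V) ∈ Finset.univ.filter fun v => v ∈ Z ∧ P v := by
    simpa using ⟨by simpa using hB.smul_mem 0 x hx, hP⟩
  rw [← Nat.cast_one, ← Nat.cast_sub (Finset.card_pos.2 ⟨0, h0⟩), ← Finset.card_erase_of_mem h0]
  congr 2
  ext v
  simp only [Finset.mem_filter, Finset.mem_univ, true_and, Finset.mem_erase]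
  tauto

variable [Fintype K]

local notation "κ" => (Fintype.card K : ℝ)

theorem sq_mul_card_not_perp (hB : IsPolarForm B Z t) {x : V} (hx : x ∈ Z) {W : Submodule K V}
    (hxW : x ∈ W) (hW : ∃ w ∈ W, B x w ≠ 0) :
    κ ^ 2 * ((Finset.univ.filter fun v => v ∈ Z ∧ v ∈ W ∧ B x v ≠ 0).card : ℝ) =
      (κ - 1) * (t * κ ^ finrank K W) := by
  have h1 := hB.card_mul_card_not_perp hx hxW
  have h2 := card_mul_card_filter_mem_and_apply_eq_zero W (B x) hW
  have h3 := Finset.card_filter_add_card_filter_not (s := Finset.univ.filter fun v => v ∈ W)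
    (fun v => B x v = 0)
  rw [Finset.filter_filter, Finset.filter_filter, card_filter_mem_submodule] at h3
  have h1' := congrArg (Nat.cast (R := ℝ)) h1
  simp only [Nat.cast_mul] at h1'
  have h2' := congrArg (Nat.cast (R := ℝ)) h2
  simp only [Nat.cast_mul, Nat.cast_pow] at h2'
  have h3' := congrArg (Nat.cast (R := ℝ)) h3
  simp only [Nat.cast_add, Nat.cast_pow] at h3'
  rw [← eq_sub_iff_add_eq'] at h3'
  rw [sq, mul_assoc, h1', h3']
  linear_combination (-t : ℝ) * h2'

/-- The parameters will be R = κ ^ (r - 1) and T = E / κ. For the collinearity matrix on points with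
ones on the diagonal, R and -T are the eigenvalues other than the valency. -/
theorem card_not_perp (hB : IsPolarForm B Z t) {x : V} (hx : x ∈ Z) (hx0 : x ≠ 0) {R T : ℝ}
    (hT : t * κ ^ finrank K V = κ ^ 2 * (κ * R * T)) :
    ((Finset.univ.filter fun v => v ∈ Z ∧ B x v ≠ 0).card : ℝ) = (κ - 1) * (κ * R * T) := by
  have hq : κ ≠ 0 := by simp
  obtain ⟨w, hw⟩ := hB.exists_not_perp hx hx0
  have h := hB.sq_mul_card_not_perp hx (W := ⊤) trivial ⟨w, trivial, hw⟩
  simp only [Submodule.mem_top, true_and, finrank_top, hT] at h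
  exact mul_left_cancel₀ (pow_ne_zero 2 hq) (by rw [h]; ring)

theorem card_perp_not_perp (hB : IsPolarForm B Z t) {x y : V} (hx : x ∈ Z) (hx0 : x ≠ 0)
    (hy : y ∈ Z) (hxy : B x y = 0) (hyx : y ∉ Submodule.span K {x}) {R T : ℝ}
    (hT : t * κ ^ finrank K V = κ ^ 2 * (κ * R * T)) :
    ((Finset.univ.filter fun v => v ∈ Z ∧ B x v = 0 ∧ B y v ≠ 0).card : ℝ) =
      (κ - 1) * (R * T) := by
  have hq : κ ≠ 0 := by simp
  have h := hB.sq_mul_card_not_perp hy (W := (B x).ker) hxy (hB.exists_perp_not_perp hx hy hxy hyx)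
  rw [← hB.finrank_ker_add_one hx hx0, pow_succ] at hT
  have hT' : t * κ ^ finrank K (B x).ker = κ ^ 2 * (R * T) := by
    refine mul_left_cancel₀ hq ?_
    linear_combination hT
  simp only [LinearMap.mem_ker, hT'] at h
  exact mul_left_cancel₀ (pow_ne_zero 2 hq) (by rw [h]; ring)

/-- Orthogonal pairs in G × Z are counted in two ways. A nonzero vector of G has a known number of
non-neighbours in Z. By maximality of G, a vector of Z outside G is orthogonal to exactly a
hyperplane of G, of R vectors. -/
theorem card_singular (hB : IsPolarForm B Z t) {G : Submodule K V}
    (hG : IsGenerator (IsElement B Z) G) {R T : ℝ} (hR : κ ^ finrank K G = κ * R)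
    (hT : t * κ ^ finrank K V = κ ^ 2 * (κ * R * T)) :
    ((Finset.univ.filter fun v => v ∈ Z).card : ℝ) = (κ * R - 1) * (κ * T) + κ * R := by
  have hq : κ ≠ 0 := by simp
  have hq1 : 1 < κ := by exact_mod_cast Fintype.one_lt_card
  have hR0 : R ≠ 0 := fun h => pow_ne_zero (finrank K G) hq (by rw [hR, h, mul_zero])
  set Zs := Finset.univ.filter fun v => v ∈ Z with hZs
  set Gs := Finset.univ.filter fun v => v ∈ G with hGs
  have hGcard : (Gs.card : ℝ) = κ * R := by
    rw [← hR]; exact_mod_cast card_filter_mem_submodule G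
  have h0 : (0 : V) ∈ Gs := by simp [hGs]
  have hsub : Gs ⊆ Zs := fun v hv => by
    simp only [hGs, hZs, Finset.mem_filter, Finset.mem_univ, true_and] at hv ⊢
    exact hG.1.1 v hv
  have hdc := Finset.sum_card_bipartiteAbove_eq_sum_card_bipartiteBelow
    (s := Gs) (t := Zs) (fun g v => B g v = 0)
  simp only [Finset.bipartiteAbove, Finset.bipartiteBelow] at hdc
  have hdc' : ∑ g ∈ Gs, ((Zs.filter fun v => B g v = 0).card : ℝ) =
      ∑ v ∈ Zs, ((Gs.filter fun g => B g v = 0).card : ℝ) := by exact_mod_cast hdc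
  have hleft : ∀ g ∈ Gs.erase 0, ((Zs.filter fun v => B g v = 0).card : ℝ) =
      Zs.card - (κ - 1) * (κ * R * T) := by
    intro g hg
    rw [Finset.mem_erase] at hg
    have hgZ : g ∈ Z := by simpa [hZs] using hsub hg.2
    rw [← hB.card_not_perp hgZ hg.1 hT, eq_sub_iff_add_eq, ← Finset.filter_filter]
    exact_mod_cast Finset.card_filter_add_card_filter_not (s := Zs) (fun v => B g v = 0)
  have hright₁ : ∀ v ∈ Gs, ((Gs.filter fun g => B g v = 0).card : ℝ) = κ * R := by
    intro v hv
    rw [Finset.filter_true_of_mem, hGcard]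
    intro g hg
    simp only [hGs, Finset.mem_filter, Finset.mem_univ, true_and] at hv hg
    exact hG.1.2 g hg v hv
  have hright₂ : ∀ v ∈ Zs \ Gs, ((Gs.filter fun g => B g v = 0).card : ℝ) = R := by
    intro v hv
    simp only [hGs, hZs, Finset.mem_sdiff, Finset.mem_filter, Finset.mem_univ, true_and] at hv
    have hex : ∃ w ∈ G, B v w ≠ 0 := by
      by_contra! h
      exact absurd (hG.2 _ (hB.isElement_sup_span hG.1 hv.1 h))
        (not_le.2 (finrank_lt_finrank_sup_span hv.2))
    have h := card_mul_card_filter_mem_and_apply_eq_zero G (B v) hex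
    have h' := congrArg (Nat.cast (R := ℝ)) h
    simp only [Nat.cast_mul, Nat.cast_pow] at h'
    rw [hR] at h'
    rw [← mul_left_cancel₀ hq h', hGs, Finset.filter_filter]
    simp only [hB.perp_comm v]
  rw [← Finset.add_sum_erase _ _ h0, Finset.sum_congr rfl hleft, ← Finset.sum_sdiff hsub,
    Finset.sum_congr rfl hright₁, Finset.sum_congr rfl hright₂, Finset.sum_const, Finset.sum_const,
    Finset.sum_const, nsmul_eq_mul, nsmul_eq_mul, nsmul_eq_mul, Finset.card_erase_of_mem h0,
    Finset.card_sdiff_of_subset hsub, Nat.cast_sub (Finset.card_pos.2 ⟨0, h0⟩),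
    Nat.cast_sub (Finset.card_le_card hsub), hGcard] at hdc'
  simp only [map_zero, LinearMap.zero_apply, Finset.filter_true, Nat.cast_one] at hdc'
  have hne : R * (κ - 1) ≠ 0 := mul_ne_zero hR0 (by linarith)
  refine mul_left_cancel₀ hne ?_
  linear_combination hdc'

/-- The number of common singular neighbours of two singular vectors. -/
theorem card_perp_perp (hB : IsPolarForm B Z t) {G : Submodule K V}
    (hG : IsGenerator (IsElement B Z) G) {R T : ℝ} (hR : κ ^ finrank K G = κ * R)
    (hT : t * κ ^ finrank K V = κ ^ 2 * (κ * R * T)) {x y : V} (hx : x ∈ Z) (hx0 : x ≠ 0)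
    (hy : y ∈ Z) (hyx : x ≠ y → y ∉ Submodule.span K {x}) :
    ((Finset.univ.filter fun v => v ∈ Z ∧ B x v = 0 ∧ B y v = 0).card : ℝ) =
      if x = y then κ * (R * T - T + R) else
        if B x y = 0 then κ * (R * T - T + R) - (κ - 1) * (R * T) else R * T - T + R := by
  have hq : κ ≠ 0 := by simp
  have hM : ((Finset.univ.filter fun v => v ∈ Z ∧ B x v = 0).card : ℝ) = κ * (R * T - T + R) := by
    have h1 := Finset.card_filter_add_card_filter_not (s := Finset.univ.filter fun v => v ∈ Z)
      (fun v => B x v = 0)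
    rw [Finset.filter_filter, Finset.filter_filter] at h1
    have h1' := congrArg (Nat.cast (R := ℝ)) h1
    simp only [Nat.cast_add] at h1'
    rw [hB.card_not_perp hx hx0 hT, hB.card_singular hG hR hT] at h1'
    linear_combination h1'
  split_ifs with hxy hperp
  · subst hxy
    simpa only [and_self] using hM
  · have h1 := Finset.card_filter_add_card_filter_not
      (s := Finset.univ.filter fun v => v ∈ Z ∧ B x v = 0) (fun v => B y v = 0)
    rw [Finset.filter_filter, Finset.filter_filter] at h1
    simp only [and_assoc] at h1
    have h1' := congrArg (Nat.cast (R := ℝ)) h1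
    simp only [Nat.cast_add] at h1'
    rw [hB.card_perp_not_perp hx hx0 hy hperp (hyx hxy) hT, hM] at h1'
    linear_combination h1'
  -- The singular vectors orthogonal to x are invariant under translation along x, and B y x ≠ 0, so
  -- exactly one in κ of them is orthogonal to y.
  · have h1 := card_mul_card_filter_apply_eq_zero
      (Finset.univ.filter fun v => v ∈ Z ∧ B x v = 0) x (fun v hv a => ?_) (B y)
      (fun h => hperp (hB.refl _ _ h))
    · rw [Finset.filter_filter] at h1
      simp only [and_assoc] at h1
      have h1' := congrArg (Nat.cast (R := ℝ)) h1
      simp only [Nat.cast_mul] at h1'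
      rw [hM] at h1'
      exact mul_left_cancel₀ hq h1'
    · simp only [Finset.mem_filter, Finset.mem_univ, true_and] at hv ⊢
      refine ⟨hB.add_mem _ hv.1 _ (hB.smul_mem _ _ hx) ?_, ?_⟩
      · rw [map_smul, hB.refl _ _ hv.2, smul_zero]
      · rw [map_add, hv.2, map_smul, hB.apply_self x hx, smul_zero, add_zero]

/-- The ratio bound for sets of points with few collinear pairs. -/
theorem card_le_of_card_perp_le (hB : IsPolarForm B Z t) {G : Submodule K V}
    (hG : IsGenerator (IsElement B Z) G) (hG0 : finrank K G ≠ 0) {E d : ℕ}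
    (hE : t * Fintype.card K ^ finrank K V = E * Fintype.card K ^ (finrank K G + 1))
    {s : Finset V} (hs : ∀ x ∈ s, x ∈ Z) (hs0 : ∀ x ∈ s, x ≠ 0)
    (hind : ∀ x ∈ s, ∀ y ∈ s, x ≠ y → y ∉ Submodule.span K {x})
    (hd : ∀ x ∈ s, (s.filter fun y => B x y = 0).card ≤ d + 1) :
    s.card ≤ E + 1 + Fintype.card K * d := by
  rcases s.eq_empty_or_nonempty with rfl | ⟨x₀, hx₀⟩
  · simp
  have hq : κ ≠ 0 := by simp
  have hq1 : 1 < κ := by exact_mod_cast Fintype.one_lt_card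
  obtain ⟨R, hRdef⟩ : ∃ R, R = κ ^ (finrank K G - 1) := ⟨_, rfl⟩
  obtain ⟨T, hTdef⟩ : ∃ T, T = (E : ℝ) / κ := ⟨_, rfl⟩
  have hTE : κ * T = E := by rw [hTdef]; field_simp
  have hR : κ ^ finrank K G = κ * R := by
    rw [hRdef, mul_comm, ← pow_succ, Nat.sub_add_cancel (by omega)]
  have hT : t * κ ^ finrank K V = κ ^ 2 * (κ * R * T) := by
    have hE' := congrArg (Nat.cast (R := ℝ)) hE
    simp only [Nat.cast_mul, Nat.cast_pow] at hE'
    rw [hE', pow_succ, hR, ← hTE]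
    ring
  have hR1 : 1 ≤ R := hRdef ▸ one_le_pow₀ hq1.le
  have hT0 : 0 ≤ T := hTdef ▸ by positivity
  set Y := Finset.univ.filter fun v => v ∈ Z ∧ v ≠ 0 with hY
  have hYcard : (Y.card : ℝ) = (κ * R - 1) * (κ * T + 1) := by
    have h1 := hB.card_filter_ne_zero (hs x₀ hx₀) (fun _ => True) trivial
    simp only [and_true, hB.card_singular hG hR hT, Finset.filter_true] at h1
    rw [hY, h1]
    ring
  -- Here `ind` plays the role of the collinearity matrix A with loops and `sp` of the identity,
  -- each point being represented by its κ - 1 nonzero vectors.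
  let ind : V → V → ℝ := fun x v => if B x v = 0 then 1 else 0
  let sp : V → V → ℝ := fun x v => if v ∈ Submodule.span K {x} then 1 else 0
  have hindind : ∀ x ∈ s, ∀ y ∈ s, ∑ v ∈ Y, ind x v * ind y v =
      (if x = y then κ * (R * T - T + R) else
        if B x y = 0 then κ * (R * T - T + R) - (κ - 1) * (R * T) else R * T - T + R) - 1 := by
    intro x hx y hy
    rw [← hB.card_perp_perp hG hR hT (hs x hx) (hs0 x hx) (hs y hy) (hind x hx y hy),
      ← hB.card_filter_ne_zero (hs x hx) (fun v => B x v = 0 ∧ B y v = 0) (by simp),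
      ← Finset.sum_boole]
    refine Finset.sum_congr rfl fun v _ => ?_
    simp only [ind]
    split_ifs <;> simp_all
  have hsp : ∀ x ∈ s, ∑ v ∈ Y, sp x v = κ - 1 := by
    intro x hx
    rw [Finset.sum_boole, hB.card_filter_ne_zero (hs x hx) _ (Submodule.zero_mem _)]
    congr 1
    have h1 := card_filter_mem_submodule (Submodule.span K {x})
    rw [finrank_span_singleton (hs0 x hx), pow_one] at h1
    rw [← h1]
    congr 2
    ext v
    simp only [Finset.mem_filter, Finset.mem_univ, true_and, and_iff_right_iff_imp]
    intro hv
    obtain ⟨a, rfl⟩ := Submodule.mem_span_singleton.1 hv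
    exact hB.smul_mem a x (hs x hx)
  have hspind : ∀ x ∈ s, ∀ y ∈ s, ∑ v ∈ Y, sp x v * ind y v = (κ - 1) * ind y x := by
    intro x hx y hy
    rw [← hsp x hx, Finset.sum_mul]
    refine Finset.sum_congr rfl fun v hv => ?_
    simp only [sp, ind]
    split_ifs with h1 h2 h3 h3 <;> try simp
    · obtain ⟨a, rfl⟩ := Submodule.mem_span_singleton.1 h1
      simp only [hY, Finset.mem_filter, Finset.mem_univ, true_and] at hv
      rw [map_smul, smul_eq_mul, mul_eq_zero] at h2
      exact h3 (h2.resolve_left fun ha => hv.2 (by rw [ha, zero_smul]))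
    · obtain ⟨a, rfl⟩ := Submodule.mem_span_singleton.1 h1
      exact h2 (by rw [map_smul, h3, smul_zero])
  have hspsp : ∀ x ∈ s, ∀ y ∈ s, ∑ v ∈ Y, sp x v * sp y v = if x = y then κ - 1 else 0 := by
    intro x hx y hy
    split_ifs with hxy
    · subst hxy
      rw [← hsp x hx]
      refine Finset.sum_congr rfl fun v _ => ?_
      simp only [sp]
      split_ifs <;> simp
    · refine Finset.sum_eq_zero fun v hv => ?_
      simp only [sp]
      split_ifs with h1 h2 <;> try simp
      obtain ⟨a, rfl⟩ := Submodule.mem_span_singleton.1 h1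
      obtain ⟨b, hb⟩ := Submodule.mem_span_singleton.1 h2
      simp only [hY, Finset.mem_filter, Finset.mem_univ, true_and] at hv
      have hb0 : b ≠ 0 := fun hb0 => hv.2 (by rw [← hb, hb0, zero_smul])
      refine hind x hx y hy hxy (Submodule.mem_span_singleton.2 ⟨b⁻¹ * a, ?_⟩)
      rw [mul_smul, ← hb, smul_smul, inv_mul_cancel₀ hb0, one_smul]
  have hsym : ∀ x y, ind x y = ind y x := fun x y => by
    simp only [ind, hB.perp_comm x y]
  have hself : ∀ x ∈ s, ind x x = 1 := fun x hx => by
    simp only [ind, hB.apply_self x (hs x hx), if_true]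
  have hsum : ∀ x ∈ s, ∑ v ∈ Y, (ind x v + T * sp x v) = (T + 1) * (κ * R - 1) := by
    intro x hx
    have h1 := hindind x hx x hx
    have h2 : ∀ v ∈ Y, ind x v * ind x v = ind x v := fun v _ => by
      simp only [ind]; split_ifs <;> simp
    rw [Finset.sum_congr rfl h2, if_pos rfl] at h1
    rw [Finset.sum_add_distrib, h1, ← Finset.mul_sum, hsp x hx]
    ring
  -- The shift by T annihilates the eigenspace of -T, so the square of A + T I is a multiple of J
  -- plus a multiple of A + T I itself.
  have hinner : ∀ x ∈ s, ∀ y ∈ s,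
      ∑ v ∈ Y, (ind x v + T * sp x v) * (ind y v + T * sp y v) =
      (R - 1) * (T + 1) + (κ - 1) * (R + T) * (ind x y + T * if x = y then 1 else 0) := by
    intro x hx y hy
    have hexp : ∀ v ∈ Y, (ind x v + T * sp x v) * (ind y v + T * sp y v) =
        ind x v * ind y v + T * (sp x v * ind y v) + T * (sp y v * ind x v) +
          T ^ 2 * (sp x v * sp y v) := fun v _ => by ring
    rw [Finset.sum_congr rfl hexp, Finset.sum_add_distrib, Finset.sum_add_distrib,
      Finset.sum_add_distrib, ← Finset.mul_sum, ← Finset.mul_sum, ← Finset.mul_sum,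
      hindind x hx y hy, hspind x hx y hy, hspind y hy x hx, hspsp x hx y hy, hsym y x]
    by_cases hxy : x = y
    · subst hxy
      simp only [if_true, hself x hx]
      ring
    · by_cases hp : B x y = 0
      · simp only [ind, hxy, hp, if_true, if_false]
        ring
      · simp only [ind, hxy, hp, if_false]
        ring
  -- Cauchy–Schwarz for the sum of the rows of A + T I indexed by s. The right side depends only on
  -- |s| and on the number of orthogonal pairs in s.
  have hcs := sq_sum_le_card_mul_sum_sq (s := Y)
    (f := fun v => ∑ x ∈ s, (ind x v + T * sp x v))
  have hlhs : ∑ v ∈ Y, ∑ x ∈ s, (ind x v + T * sp x v) = s.card * ((T + 1) * (κ * R - 1)) := by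
    rw [Finset.sum_comm, Finset.sum_congr rfl hsum, Finset.sum_const, nsmul_eq_mul]
  have hrhs : ∑ v ∈ Y, (∑ x ∈ s, (ind x v + T * sp x v)) ^ 2 ≤
      s.card * s.card * ((R - 1) * (T + 1)) +
        (κ - 1) * (R + T) * (s.card * (d + 1) + T * s.card) := by
    have h1 : ∑ v ∈ Y, (∑ x ∈ s, (ind x v + T * sp x v)) ^ 2 =
        ∑ x ∈ s, ∑ y ∈ s, ((R - 1) * (T + 1) +
          (κ - 1) * (R + T) * (ind x y + T * if x = y then 1 else 0)) := by
      simp only [sq, Finset.sum_mul_sum]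
      rw [Finset.sum_comm]
      refine Finset.sum_congr rfl fun x hx => ?_
      rw [Finset.sum_comm]
      exact Finset.sum_congr rfl fun y hy => hinner x hx y hy
    have h2 : ∀ x ∈ s, ∑ y ∈ s, ((R - 1) * (T + 1) +
          (κ - 1) * (R + T) * (ind x y + T * if x = y then 1 else 0)) ≤
        s.card * ((R - 1) * (T + 1)) + (κ - 1) * (R + T) * ((d + 1) + T) := by
      intro x hx
      have hdeg : ∑ y ∈ s, ind x y ≤ d + 1 := by
        simp only [ind, Finset.sum_boole]
        exact_mod_cast hd x hx
      rw [Finset.sum_add_distrib, Finset.sum_const, nsmul_eq_mul, ← Finset.mul_sum,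
        Finset.sum_add_distrib, ← Finset.mul_sum, Finset.sum_ite_eq, if_pos hx, mul_one]
      have : 0 ≤ (κ - 1) * (R + T) := mul_nonneg (by linarith) (by linarith)
      gcongr
    rw [h1]
    refine (Finset.sum_le_sum h2).trans (le_of_eq ?_)
    rw [Finset.sum_const, nsmul_eq_mul]
    ring
  rw [hlhs, hYcard] at hcs
  have hnn : 0 ≤ (κ * R - 1) * (κ * T + 1) := by rw [← hYcard]; positivity
  have := le_of_ratio_inequality hq1 hR1 hT0 (Nat.cast_nonneg d) (Nat.cast_nonneg s.card)
    (hcs.trans (mul_le_mul_of_nonneg_left hrhs hnn))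
  rw [hTE] at this
  exact_mod_cast this

end IsPolarForm

end Spectral

/-! ### From quotients at points to partial 2-ovoids -/

section PartialTwoOvoids

open scoped Classical

variable {K V : Type*} [Field K] [AddCommGroup V] [Module K V]

theorem rep_injective : Function.Injective (Projectivization.rep : ℙ K V → V) := fun P Q h => by
  rw [← P.mk_rep, ← Q.mk_rep]
  simp only [h]

theorem eq_of_rep_mem_span {P Q : ℙ K V} (h : Q.rep ∈ Submodule.span K {P.rep}) : P = Q := by
  obtain ⟨a, ha⟩ := Submodule.mem_span_singleton.1 h
  rw [← P.mk_rep, ← Q.mk_rep, eq_comm, Projectivization.mk_eq_mk_iff']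
  exact ⟨a, ha⟩

namespace IsPolarForm

variable [FiniteDimensional K V]

variable {σ : K →+* K} {B : V →ₛₗ[σ] V →ₗ[K] K} {Z : Set V} {t : ℕ}

/-- A complement of x in its perp serves as a model of the quotient: each vector orthogonal to x is
moved into it by a multiple of x. The n - 2 spanning vectors supply the number of variables in the
p-rank bounds. -/
theorem exists_family_perp (hB : IsPolarForm B Z t) {x : V} (hx : x ∈ Z) (hx0 : x ≠ 0) :
    ∃ e : Fin (finrank K V - 2) → V,
      ∀ y, B x y = 0 → ∃ a : K, y + a • x ∈ Submodule.span K (Set.range e) := by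
  have hker := hB.finrank_ker_add_one hx hx0
  let x' : (B x).ker := ⟨x, hB.apply_self x hx⟩
  have hx' : x' ≠ 0 := fun h => hx0 (congrArg Subtype.val h)
  obtain ⟨W, hW⟩ := Submodule.exists_isCompl (Submodule.span K {x'})
  have hfr := Submodule.finrank_add_eq_of_isCompl hW
  rw [finrank_span_singleton hx'] at hfr
  let b := Module.finBasisOfFinrankEq K W (show finrank K W = finrank K V - 2 by omega)
  refine ⟨fun c => ((b c : (B x).ker) : V), fun y hy => ?_⟩
  have hmem : (⟨y, hy⟩ : (B x).ker) ∈ Submodule.span K {x'} ⊔ W := by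
    rw [hW.sup_eq_top]; trivial
  obtain ⟨_, hu, w, hw, hsum⟩ := Submodule.mem_sup.1 hmem
  obtain ⟨a, rfl⟩ := Submodule.mem_span_singleton.1 hu
  refine ⟨-a, ?_⟩
  have hyw : y + -a • x = w := by
    have : y = a • x + w := by simpa using (congrArg Subtype.val hsum).symm
    rw [this]
    module
  rw [hyw, Submodule.mem_span_range_iff_exists_fun]
  refine ⟨b.repr ⟨w, hw⟩, ?_⟩
  have := congrArg (fun z : W => ((z : (B x).ker) : V)) (b.sum_repr ⟨w, hw⟩)
  refine Eq.trans ?_ this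
  simp only [AddSubmonoidClass.coe_finsetSum, Submodule.coe_smul]

/-- No three points of a partial `2`-ovoid are pairwise orthogonal. -/
theorem not_perp_of_isPartialOvoid (hB : IsPolarForm B Z t) {O : Set (ℙ K V)}
    (hO : IsPartialOvoid (IsElement B Z) 2 O) {P Q R : ℙ K V} (hP : P ∈ O) (hQ : Q ∈ O)
    (hR : R ∈ O) (hPQ : P ≠ Q) (hPR : P ≠ R) (hQR : Q ≠ R) (h1 : B P.rep Q.rep = 0)
    (h2 : B P.rep R.rep = 0) : B Q.rep R.rep ≠ 0 := by
  intro h3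
  have hmem : ∀ P ∈ O, P.rep ∈ Z := fun P hP => (hO.1 P hP).1 _ (by
    rw [P.submodule_eq]; exact Submodule.mem_span_singleton_self _)
  have hW₂ := hB.isElement_sup_span (hO.1 P hP) (hmem Q hQ) (fun w hw => by
    rw [P.submodule_eq] at hw
    obtain ⟨a, rfl⟩ := Submodule.mem_span_singleton.1 hw
    rw [map_smul, hB.refl _ _ h1, smul_zero])
  have hW₃ := hB.isElement_sup_span hW₂ (hmem R hR) (fun w hw => by
    obtain ⟨w₁, hw₁, w₂, hw₂, rfl⟩ := Submodule.mem_sup.1 hw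
    rw [P.submodule_eq] at hw₁
    obtain ⟨a, rfl⟩ := Submodule.mem_span_singleton.1 hw₁
    obtain ⟨b, rfl⟩ := Submodule.mem_span_singleton.1 hw₂
    rw [map_add, map_smul, map_smul, hB.refl _ _ h2, hB.refl _ _ h3, smul_zero, smul_zero,
      add_zero])
  obtain ⟨G, hle, hG⟩ := hB.exists_generator hW₃
  have hsub : ({P, Q, R} : Set (ℙ K V)) ⊆ {P ∈ O | P.submodule ≤ G} := by
    rintro _ (rfl | rfl | rfl)
    · exact ⟨hP, (le_sup_left.trans le_sup_left).trans hle⟩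
    · refine ⟨hQ, le_trans ?_ hle⟩
      rw [Projectivization.submodule_eq]
      exact le_sup_right.trans le_sup_left
    · refine ⟨hR, le_trans ?_ hle⟩
      rw [Projectivization.submodule_eq]
      exact le_sup_right
  have hcard := (Set.encard_le_encard hsub).trans (hO.2 G hG)
  rw [Set.encard_insert_of_notMem (by simp [hPQ, hPR]), Set.encard_pair hQR] at hcard
  exact absurd hcard (by norm_num)

/-- Bounds for partial ovoids in the quotients at points give bounds for partial `2`-ovoids. -/
theorem ncard_le_of_isPartialOvoid [Finite K] (hB : IsPolarForm B Z t) {r : ℕ}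
    (hrank : HasRank (IsElement B Z) r) (hr : r ≠ 0) {E m : ℕ}
    (hE : t * Nat.card K ^ finrank K V = E * Nat.card K ^ (r + 1))
    (hm : ∀ (e : Fin (finrank K V - 2) → V) (s : Finset V),
      (∀ x ∈ s, x ∈ Submodule.span K (Set.range e)) → (∀ x ∈ s, x ∈ Z) →
      (∀ x ∈ s, ∀ y ∈ s, x ≠ y → B x y ≠ 0) → s.card ≤ m + 1)
    {O : Set (ℙ K V)} (hO : IsPartialOvoid (IsElement B Z) 2 O) :
    O.ncard ≤ E + 1 + Nat.card K * (m + 1) := by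
  have : Finite V := Module.finite_of_finite K
  have := Fintype.ofFinite K
  have := Fintype.ofFinite V
  have : Finite (ℙ K V) := Finite.of_injective _ rep_injective
  have := Fintype.ofFinite (ℙ K V)
  obtain ⟨⟨G, hG, hGr⟩, hmax⟩ := hrank
  have hGgen : IsGenerator (IsElement B Z) G := ⟨hG, fun U hU => hGr ▸ hmax ⟨U, hU, rfl⟩⟩
  have hmem : ∀ P ∈ O, P.rep ∈ Z := fun P hP => (hO.1 P hP).1 _ (by
    rw [P.submodule_eq]; exact Submodule.mem_span_singleton_self _)
  have hcard : O.ncard = (O.toFinset.image Projectivization.rep).card := by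
    rw [Finset.card_image_of_injective _ rep_injective, Set.ncard_eq_toFinset_card']
  rw [Nat.card_eq_fintype_card] at hE ⊢
  rw [hcard]
  refine hB.card_le_of_card_perp_le hGgen (by omega) (by rw [hE, hGr]) ?_ ?_ ?_ ?_
  · simp only [Finset.mem_image, Set.mem_toFinset]
    rintro _ ⟨P, hP, rfl⟩
    exact hmem P hP
  · simp only [Finset.mem_image, Set.mem_toFinset]
    rintro _ ⟨P, hP, rfl⟩
    exact P.rep_nonzero
  · simp only [Finset.mem_image, Set.mem_toFinset]
    rintro _ ⟨P, hP, rfl⟩ _ ⟨Q, hQ, rfl⟩ hne hspan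
    exact hne (congrArg _ (eq_of_rep_mem_span hspan))
  · simp only [Finset.mem_image, Set.mem_toFinset]
    rintro _ ⟨P, hP, rfl⟩
    set s := (O.toFinset.image Projectivization.rep).filter fun y => B P.rep y = 0 with hs
    have hPs : P.rep ∈ s := by
      simp only [hs, Finset.mem_filter, Finset.mem_image, Set.mem_toFinset]
      exact ⟨⟨P, hP, rfl⟩, hB.apply_self _ (hmem P hP)⟩
    -- P is orthogonal to itself, which accounts for the extra 1; only its true neighbours have to
    -- be bounded by m + 1.
    rw [← Finset.card_erase_add_one hPs]
    refine Nat.add_le_add_right ?_ 1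
    have hs' : ∀ y ∈ s.erase P.rep, ∃ Q ∈ O, P ≠ Q ∧ Q.rep = y ∧ B P.rep Q.rep = 0 := by
      intro y hy
      simp only [hs, Finset.mem_erase, Finset.mem_filter, Finset.mem_image,
        Set.mem_toFinset] at hy
      obtain ⟨hne, ⟨Q, hQ, rfl⟩, hperp⟩ := hy
      exact ⟨Q, hQ, fun h => hne (by rw [h]), rfl, hperp⟩
    obtain ⟨e, he⟩ := hB.exists_family_perp (hmem P hP) P.rep_nonzero
    choose! a ha using he
    -- P lies in the radical of its own perp, so moving neighbours into the complement does not
    -- change the form.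
    have hform : ∀ y ∈ s.erase P.rep, ∀ z ∈ s.erase P.rep,
        B (y + a y • P.rep) (z + a z • P.rep) = B y z := by
      intro y hy z hz
      obtain ⟨Q, hQ, -, rfl, hPQ⟩ := hs' y hy
      obtain ⟨R, hR, -, rfl, hPR⟩ := hs' z hz
      simp [hPR, hB.refl _ _ hPQ, hB.apply_self _ (hmem P hP)]
    have hne : ∀ y ∈ s.erase P.rep, ∀ z ∈ s.erase P.rep, y ≠ z → B y z ≠ 0 := by
      intro y hy z hz hyz
      obtain ⟨Q, hQ, hPQ', rfl, hPQ⟩ := hs' y hy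
      obtain ⟨R, hR, hPR', rfl, hPR⟩ := hs' z hz
      exact hB.not_perp_of_isPartialOvoid hO hP hQ hR hPQ' hPR' (fun h => hyz (by rw [h])) hPQ hPR
    have hZ : ∀ y ∈ s.erase P.rep, y + a y • P.rep ∈ Z := by
      intro y hy
      obtain ⟨Q, hQ, -, rfl, hPQ⟩ := hs' y hy
      refine hB.add_mem _ (hmem Q hQ) _ (hB.smul_mem _ _ (hmem P hP)) ?_
      rw [map_smul, hB.refl _ _ hPQ, smul_zero]
    -- Two neighbours with the same image would be orthogonal, since the image is singular.
    have hinj : Set.InjOn (fun y => y + a y • P.rep) (s.erase P.rep : Finset V) := by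
      intro y hy z hz hyz
      by_contra hcon
      refine hne y hy z hz hcon ?_
      dsimp only at hyz
      rw [← hform y hy z hz, hyz]
      exact hB.apply_self _ (hZ z hz)
    rw [← Finset.card_image_of_injOn hinj]
    refine hm e _ ?_ ?_ ?_
    · simp only [Finset.mem_image]
      rintro _ ⟨y, hy, rfl⟩
      obtain ⟨Q, hQ, -, rfl, hPQ⟩ := hs' y hy
      exact ha _ hPQ
    · simp only [Finset.mem_image]
      rintro _ ⟨y, hy, rfl⟩
      exact hZ y hy
    · simp only [Finset.mem_image]
      rintro _ ⟨y, hy, rfl⟩ _ ⟨z, hz, rfl⟩ hyz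
      rw [hform y hy z hz]
      exact hne y hy z hz fun h => hyz (by rw [h])

end IsPolarForm

end PartialTwoOvoids

/-! ### Trace and norm from a field of order q^2 -/

section FiniteFields

open scoped Classical
open Polynomial

variable {K : Type*} [Field K]

/-- If a single fibre had fewer than c elements, the total would fall below |A'| c. For trace and
norm, root counts bound both the fibres and the target. -/
theorem card_fiber_eq {α β : Type*} {A : Finset α} {A' : Finset β} {f : α → β} {c : ℕ}
    (hf : ∀ a ∈ A, f a ∈ A') (hc : ∀ b ∈ A', (A.filter fun a => f a = b).card ≤ c)
    (h : A'.card * c ≤ A.card) : ∀ b ∈ A', (A.filter fun a => f a = b).card = c := by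
  by_contra! hcon
  obtain ⟨b, hb, hne⟩ := hcon
  have h1 := Finset.card_eq_sum_card_fiberwise hf
  have h2 := Finset.sum_lt_sum hc ⟨b, hb, lt_of_le_of_ne (hc b hb) hne⟩
  rw [← h1, Finset.sum_const, smul_eq_mul] at h2
  omega

theorem card_filter_le_natDegree {P : K[X]} (hP : P ≠ 0) (A : Finset K)
    (hA : ∀ a ∈ A, P.eval a = 0) : A.card ≤ P.natDegree :=
  Polynomial.card_le_degree_of_subset_roots fun a ha => (mem_roots hP).2 (hA a ha)

variable [Fintype K]

theorem pow_pow_eq_self {q : ℕ} (hK : Fintype.card K = q ^ 2) (x : K) : (x ^ q) ^ q = x := by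
  rw [← pow_mul, ← sq, ← hK, FiniteField.pow_card]

theorem card_add_pow_eq {p h q : ℕ} [Fact p.Prime] [CharP K p] (hq : q = p ^ h) (hq1 : 1 < q)
    (hK : Fintype.card K = q ^ 2) {s : K} (hs : s ^ q = s) :
    (Finset.univ.filter fun w : K => w + w ^ q = s).card = q := by
  refine card_fiber_eq (A := Finset.univ) (A' := Finset.univ.filter fun s : K => s ^ q = s)
    (f := fun w => w + w ^ q) (fun w _ => ?_) (fun s _ => ?_) ?_ s (by simpa using hs)
  · simp only [Finset.mem_filter, Finset.mem_univ, true_and]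
    have : (w + w ^ q) ^ q = w ^ q + (w ^ q) ^ q := by
      subst hq
      exact add_pow_char_pow w (w ^ p ^ h) p h
    rw [this, pow_pow_eq_self hK, add_comm]
  · have hdeg : (X ^ q + (X - C s) : K[X]).natDegree = q := by
      rw [natDegree_add_eq_left_of_natDegree_lt] <;> simp [hq1]
    have := card_filter_le_natDegree (P := X ^ q + (X - C s))
      (ne_zero_of_natDegree_gt (n := 0) (by omega))
      (Finset.univ.filter fun w : K => w + w ^ q = s) (fun w hw => by
        simp only [Finset.mem_filter, Finset.mem_univ, true_and] at hw
        simp only [eval_add, eval_pow, eval_X, eval_sub, eval_C, ← hw]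
        ring)
    omega
  · have hdeg : (X ^ q - X : K[X]).natDegree = q := FiniteField.X_pow_card_sub_X_natDegree_eq K hq1
    have := card_filter_le_natDegree (P := X ^ q - X)
      (ne_zero_of_natDegree_gt (n := 0) (by omega))
      (Finset.univ.filter fun w : K => w ^ q = w) (fun w hw => by
        simp only [Finset.mem_filter, Finset.mem_univ, true_and] at hw
        simp [hw])
    rw [Finset.card_univ, hK, sq]
    exact Nat.mul_le_mul_right q (this.trans hdeg.le)

/-- The norm maps the q^2 - 1 nonzero elements to at most q - 1 roots of X^(q-1) - 1, with fibres of
size at most q + 1, so every fibre is full. -/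
theorem exists_pow_succ_eq {q : ℕ} (hq1 : 1 < q) (hK : Fintype.card K = q ^ 2) {s : K}
    (hs : s ^ q = s) (hs0 : s ≠ 0) : ∃ a : K, a ^ (q + 1) = s := by
  have hpred : ∀ {s : K}, s ^ q = s → s ≠ 0 → s ^ (q - 1) = 1 := fun {s} hs hs0 => by
    refine mul_right_cancel₀ hs0 ?_
    rw [← pow_succ, Nat.sub_add_cancel hq1.le, hs, one_mul]
  have hsq : (q - 1) * (q + 1) = q ^ 2 - 1 := by
    have := Nat.sq_sub_sq q 1
    rw [one_pow] at this
    rw [this, mul_comm]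
  have h := card_fiber_eq (A := Finset.univ.erase (0 : K))
    (A' := Finset.univ.filter fun s : K => s ^ (q - 1) = 1)
    (f := fun w => w ^ (q + 1)) (c := q + 1) (fun w hw => ?_) (fun s _ => ?_) ?_ s
    (by simpa using hpred hs hs0)
  · obtain ⟨a, ha⟩ := Finset.card_pos.1 (h.trans_gt (Nat.succ_pos q))
    exact ⟨a, (Finset.mem_filter.1 ha).2⟩
  · rw [Finset.mem_erase] at hw
    simp only [Finset.mem_filter, Finset.mem_univ, true_and]
    rw [← pow_mul, mul_comm, hsq, ← hK, FiniteField.pow_card_sub_one_eq_one w hw.1]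
  · have := card_filter_le_natDegree (X_pow_sub_C_ne_zero (Nat.succ_pos q) s)
      ((Finset.univ.erase (0 : K)).filter fun w : K => w ^ (q + 1) = s) (fun w hw => by
        simp [(Finset.mem_filter.1 hw).2])
    rwa [natDegree_X_pow_sub_C] at this
  · have := card_filter_le_natDegree (X_pow_sub_C_ne_zero (show 0 < q - 1 by omega) (1 : K))
      (Finset.univ.filter fun w : K => w ^ (q - 1) = 1) (fun w hw => by
        have := (Finset.mem_filter.1 hw).2
        simp [this])
    rw [natDegree_X_pow_sub_C] at this
    rw [Finset.card_erase_of_mem (Finset.mem_univ _), Finset.card_univ, hK, ← hsq]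
    exact Nat.mul_le_mul_right _ this

end FiniteFields

/-! ### Alternating, quadratic and Hermitian forms as polar forms -/

section ClassicalForms

variable {K V : Type*} [Field K] [AddCommGroup V] [Module K V]

theorem isPolarForm_of_isAlt {B : LinearMap.BilinForm K V} (hB : B.IsAlt) (hn : B.Nondegenerate) :
    IsPolarForm B Set.univ (Nat.card K) where
  refl x y h := hB.isRefl x y h
  smul_mem _ _ _ := trivial
  add_mem _ _ _ _ _ := trivial
  apply_self x _ := hB x
  apply_ne_zero x _ hx h := hx (hn.1 x fun y => by rw [h]; rfl)
  card_line x _ v _ := Nat.card_congr (Equiv.subtypeUnivEquiv fun _ => trivial)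

theorem isElement_univ {σ : K →+* K} (B : V →ₛₗ[σ] V →ₗ[K] K) :
    IsElement B Set.univ = TotallyIsotropic B := by
  funext W
  simp [IsElement]

theorem isPolarForm_polarBilin {Q : QuadraticForm K V} (hQ : Q.Nondegenerate) :
    IsPolarForm Q.polarBilin {x | Q x = 0} 1 where
  refl x y h := by
    rw [QuadraticMap.polarBilin_apply_apply] at h ⊢
    rwa [QuadraticMap.polar_comm]
  smul_mem a x hx := by
    have hx : Q x = 0 := hx
    simp [QuadraticMap.map_smul, hx]
  add_mem x hx y hy h := by
    have hx : Q x = 0 := hx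
    have hy : Q y = 0 := hy
    rw [QuadraticMap.polarBilin_apply_apply] at h
    simp [QuadraticMap.map_add Q, hx, hy, h]
  apply_self x hx := by
    have hx : Q x = 0 := hx
    simp [hx]
  apply_ne_zero x hx hx0 h := by
    have : x ∈ Q.radical := ⟨hx, h⟩
    rw [hQ.radical_eq_bot] at this
    exact hx0 this
  card_line x hx v hv := by
    have hx : Q x = 0 := hx
    rw [QuadraticMap.polarBilin_apply_apply, QuadraticMap.polar_comm] at hv
    have hiff : ∀ a : K, v + a • x ∈ {x | Q x = 0} ↔ a = -Q v / QuadraticMap.polar Q v x := by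
      intro a
      rw [Set.mem_ofPred_eq, QuadraticMap.map_add Q, QuadraticMap.map_smul, hx, smul_zero,
        QuadraticMap.polar_smul_right, smul_eq_mul, eq_div_iff hv]
      constructor <;> intro h <;> linear_combination h
    simp only [hiff]
    simp

theorem isElement_polarBilin (Q : QuadraticForm K V) :
    IsElement Q.polarBilin {x | Q x = 0} = TotallySingular Q := by
  funext W
  refine propext ⟨fun h => h.1, fun h => ⟨h, fun x hx y hy => ?_⟩⟩
  simp [QuadraticMap.polar, h x hx, h y hy, h _ (W.add_mem hx hy)]

theorem isElement_hermitian {σ : K →+* K} (B : V →ₛₗ[σ] V →ₗ[K] K) :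
    IsElement B {x | B x x = 0} = TotallyIsotropic B := by
  funext W
  exact propext ⟨fun h => h.2, fun h => ⟨fun x hx => h x hx x hx, h⟩⟩

theorem isPolarForm_hermitian {p h q : ℕ} (hp : p.Prime) (h0 : h ≠ 0) (hq : q = p ^ h)
    (hK : Nat.card K = q ^ 2) {σ : K →+* K} (hσ : ∀ x, σ x = x ^ q) {B : V →ₛₗ[σ] V →ₗ[K] K}
    (hB : B.IsSymm) (hn : B.Nondegenerate) : IsPolarForm B {x | B x x = 0} q where
  refl x y h := by rw [← hB.eq, h, map_zero]
  smul_mem a x hx := by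
    have hx : B x x = 0 := hx
    simp [hx]
  add_mem x hx y hy h := by
    have hx : B x x = 0 := hx
    have hy : B y y = 0 := hy
    have h' : B y x = 0 := by rw [← hB.eq, h, map_zero]
    simp [hx, hy, h, h']
  apply_self x hx := hx
  apply_ne_zero x _ hx h := hx (hn.1 x fun y => by rw [h]; rfl)
  card_line x hx v hv := by
    classical
    have : Fact p.Prime := ⟨hp⟩
    have hq1 : 1 < q := hq ▸ Nat.one_lt_pow h0 hp.one_lt
    have : Finite K := Nat.finite_of_card_ne_zero (by rw [hK]; positivity)
    have := Fintype.ofFinite K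
    have : CharP K p := charP_of_natCard (h := h * 2) (by rw [hK, hq, pow_mul])
    rw [Nat.card_eq_fintype_card] at hK
    have hx : B x x = 0 := hx
    have hvx : B v x ≠ 0 := fun h => hv (by rw [← hB.eq, h, map_zero])
    have hs : (-B v v) ^ q = -B v v := by rw [← hσ, map_neg, hB.eq]
    rw [← card_add_pow_eq hq hq1 hK hs, ← Fintype.card_subtype, ← Nat.card_eq_fintype_card]
    -- With w = a * B v x, the vector v + a x is isotropic exactly when w + w^q = -B v v, so t is
    -- the size of a trace fibre.
    refine Nat.card_congr ((Equiv.mulRight₀ (B v x) hvx).subtypeEquiv fun a => ?_)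
    rw [Set.mem_ofPred_eq, Equiv.mulRight₀_apply, ← hσ (a * _), map_mul, hB.eq]
    simp only [map_add, LinearMap.add_apply, map_smul, LinearMap.map_smulₛₗ, LinearMap.smul_apply,
      smul_eq_mul, hx, mul_zero, add_zero]
    constructor <;> intro h <;> linear_combination h

end ClassicalForms

/-! ### Dimension and rank -/

section Dimension

variable {K V : Type*} [Field K] [AddCommGroup V] [Module K V] [FiniteDimensional K V]
  {σ : K →+* K} {B : V →ₛₗ[σ] V →ₗ[K] K}

theorem exists_perp_notMem (B : V →ₛₗ[σ] V →ₗ[K] K) (G : Submodule K V) {m : ℕ} (f : Fin m → V)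
    (h : m + finrank K G < finrank K V) : ∃ v ∉ G, ∀ i, B (f i) v = 0 := by
  let φ : V →ₗ[K] (Fin m → K) := LinearMap.pi fun i => B (f i)
  have hker := φ.finrank_range_add_finrank_ker
  have hran : finrank K φ.range ≤ m := by simpa using Submodule.finrank_le φ.range
  by_contra! hcon
  have hle : φ.ker ≤ G := by
    intro v hv
    by_contra hvG
    obtain ⟨i, hi⟩ := hcon v hvG
    exact hi (congrFun hv i)
  have := Submodule.finrank_mono hle
  omega

/-- A Hermitian form of Witt index `r` lives in dimension at most `2 r + 1`. -/
theorem finrank_le_of_hermitian {p h q r : ℕ} (hp : p.Prime) (h0 : h ≠ 0) (hq : q = p ^ h)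
    (hK : Nat.card K = q ^ 2) (hσ : ∀ x, σ x = x ^ q) (hB : B.IsSymm) (hn : B.Nondegenerate)
    (hrank : HasRank (TotallyIsotropic B) r) : finrank K V ≤ 2 * r + 1 := by
  have hpol := isPolarForm_hermitian hp h0 hq hK hσ hB hn
  rw [← isElement_hermitian] at hrank
  obtain ⟨⟨G, hG, hGr⟩, hmax⟩ := hrank
  by_contra! hlt
  have hq1 : 1 < q := hq ▸ Nat.one_lt_pow h0 hp.one_lt
  have : Finite K := Nat.finite_of_card_ne_zero (by rw [hK]; positivity)
  have := Fintype.ofFinite K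
  rw [Nat.card_eq_fintype_card] at hK
  let b := Module.finBasisOfFinrankEq K G hGr
  have hperp : ∀ v, (∀ i, B (b i : V) v = 0) → ∀ g ∈ G, B v g = 0 := by
    intro v hv g hg
    have hle : G ≤ (B v).ker := by
      have hbs : Submodule.map G.subtype ⊤ = G := by simp
      rw [← hbs, ← b.span_eq, Submodule.map_span, Submodule.span_le]
      rintro _ ⟨_, ⟨i, rfl⟩, rfl⟩
      exact hpol.refl _ _ (hv i)
    exact hle hg
  have hmem : ∀ v, (∀ g ∈ G, B v g = 0) → B v v = 0 → v ∈ G := by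
    intro v hv hvv
    by_contra hvG
    have h1 := hmax ⟨_, hpol.isElement_sup_span hG hvv hv, rfl⟩
    have h2 := IsPolarForm.finrank_lt_finrank_sup_span hvG
    omega
  -- In dimension at least 2 r + 2 the perp of G contains orthogonal vectors v and w outside G,
  -- non-isotropic by maximality of G. As norms are surjective, some v + a w is isotropic and hence
  -- in G, yet its product with v is B v v ≠ 0.
  obtain ⟨v, hvG, hv⟩ := exists_perp_notMem B G (fun i => (b i : V)) (by omega)
  obtain ⟨w, hwG, hw⟩ := exists_perp_notMem B G (Fin.cons v fun i => (b i : V) : Fin (r + 1) → V)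
    (by omega)
  have hvw : B v w = 0 := by simpa using hw 0
  have hw' : ∀ i, B (b i : V) w = 0 := fun i => by simpa using hw i.succ
  have hvv : B v v ≠ 0 := fun h => hvG (hmem v (hperp v hv) h)
  have hww : B w w ≠ 0 := fun h => hwG (hmem w (hperp w hw') h)
  obtain ⟨a, ha⟩ := exists_pow_succ_eq (s := -(B v v / B w w)) hq1 hK
    (by rw [← hσ, map_neg, map_div₀, hB.eq, hB.eq]) (neg_ne_zero.2 (div_ne_zero hvv hww))
  have haσ : a * σ a = -(B v v / B w w) := by rw [hσ, ← pow_succ', ha]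
  have hu : v + a • w ∈ G := by
    refine hmem _ (fun g hg => ?_) ?_
    · simp [hperp v hv g hg, hperp w hw' g hg]
    · simp only [map_add, LinearMap.add_apply, map_smul, LinearMap.map_smulₛₗ,
        LinearMap.smul_apply, smul_eq_mul, hvw, hpol.refl _ _ hvw, mul_zero, add_zero, zero_add]
      rw [← mul_assoc, haσ]
      field_simp
      ring
  have := hperp v hv _ hu
  rw [map_add, map_smul, hvw, smul_zero, add_zero] at this
  exact hvv this

/-- A generator lies in the perp of any of its nonzero vectors, a hyperplane. For Hermitian spaces
this keeps the natural subtractions in exponents and binomials from truncating. -/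
theorem IsPolarForm.rank_lt_finrank {Z : Set V} {t r : ℕ} (hB : IsPolarForm B Z t)
    (hrank : HasRank (IsElement B Z) r) (hr : r ≠ 0) : r < finrank K V := by
  obtain ⟨⟨G, hG, rfl⟩, -⟩ := hrank
  obtain ⟨x, hx, hx0⟩ := Submodule.exists_mem_ne_zero_of_ne_bot (p := G) (by
    rintro rfl
    simp at hr)
  have h1 := hB.finrank_ker_add_one (hG.1 x hx) hx0
  have h2 := Submodule.finrank_mono (show G ≤ (B x).ker from fun g hg => hG.2 x hx g hg)
  omega

end Dimension

end PolarSpace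

/-! ### The bounds for the three families -/

open PolarSpace in
theorem corollary4p4 (p h q r : ℕ) (hp : p.Prime) (hh : 0 < h) (hq : q = p ^ h) (hr : 3 ≤ r) :
    -- the symplectic spaces W(2r-1,q)
    (∀ (K : Type*) [Field K] (V : Type*) [AddCommGroup V] [Module K V] [FiniteDimensional K V]
        (B : LinearMap.BilinForm K V) (O : Set (ℙ K V)),
      Nat.card K = q → Module.finrank K V = 2 * r →
      B.IsAlt → B.Nondegenerate → HasRank (TotallyIsotropic B) r →
      IsPartialOvoid (TotallyIsotropic B) 2 O →
      O.ncard ≤ q ^ r + q + 1 + q * ((p + 2 * r - 3).choose (p - 1)) ^ h) ∧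
    -- the quadrics Q^ε(n-1,q): hyperbolic (ε = 1), parabolic (ε = 0), elliptic (ε = -1)
    (∀ (K : Type*) [Field K] (V : Type*) [AddCommGroup V] [Module K V] [FiniteDimensional K V]
        (Q : QuadraticForm K V) (O : Set (ℙ K V)) (n : ℕ) (ε : ℤ),
      Nat.card K = q → Module.finrank K V = n →
      (ε = 1 ∨ ε = 0 ∨ ε = -1) → (n : ℤ) = 2 * r + 1 - ε →
      Q.Nondegenerate → HasRank (TotallySingular Q) r →
      IsPartialOvoid (TotallySingular Q) 2 O →
      (O.ncard : ℤ) ≤ (q : ℤ) ^ ((r : ℤ) - ε).toNat + q + 1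
        + q * (binom (n + p - 4) (p - 1) - binom (n + p - 6) (p - 3)) ^ h) ∧
    -- the Hermitian spaces H(n-1,q^2), n odd and n even
    (∀ (K : Type*) [Field K] (V : Type*) [AddCommGroup V] [Module K V] [FiniteDimensional K V]
        (σ : K →+* K) (B : V →ₛₗ[σ] V →ₗ[K] K) (O : Set (ℙ K V)) (n : ℕ),
      Nat.card K = q ^ 2 → Module.finrank K V = n → (∀ x, σ x = x ^ q) →
      B.IsSymm → B.Nondegenerate → HasRank (TotallyIsotropic B) r →
      IsPartialOvoid (TotallyIsotropic B) 2 O →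
      (Odd n → (O.ncard : ℤ) ≤ (q : ℤ) ^ (2 * r + 1) + q ^ 2 + 1
        + q ^ 2 * (binom (n + p - 4) (p - 1) ^ 2 - binom (n + p - 5) (p - 2) ^ 2) ^ h) ∧
      (Even n → (O.ncard : ℤ) ≤ (q : ℤ) ^ (2 * r - 1) + q ^ 2 + 1
        + q ^ 2 * (binom (n + p - 4) (p - 1) ^ 2 - binom (n + p - 5) (p - 2) ^ 2) ^ h)) := by
  have : Fact p.Prime := ⟨hp⟩
  have hp2 := hp.two_le
  have hq1 : 1 < q := hq ▸ Nat.one_lt_pow hh.ne' hp.one_lt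
  have hbinom : ∀ (a k : ℕ), binom a k = a.choose k := fun a k => by simp [binom]
  have hbinom1 : ∀ a : ℕ, binom a ((p : ℤ) - 1) = a.choose (p - 1) := fun a => by
    rw [← hbinom]; congr; omega
  have hbinom2 : ∀ a : ℕ, binom a ((p : ℤ) - 2) = a.choose (p - 2) := fun a => by
    rw [← hbinom]; congr; omega
  refine ⟨?_, ?_, ?_⟩
  · intro K _ V _ _ _ B O hK hV hB hn hrank hO
    have hfin : Finite K := Nat.finite_of_card_ne_zero (by omega)
    rw [← isElement_univ] at hrank hO
    have hbound := (isPolarForm_of_isAlt hB hn).ncard_le_of_isPartialOvoid hrank (by omega)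
      (E := q ^ r) (m := (p + 2 * r - 3).choose (p - 1) ^ h) (by rw [hK, hV]; ring) ?_ hO
    · rw [hK] at hbound
      linarith
    · intro e s hs _ hne
      refine (card_le_symplectic hh.ne' (hK.trans hq) B hs fun x hx y hy => ⟨fun hxy => ?_, ?_⟩).trans
        ?_
      · exact by_contra fun h => hne x hx y hy h hxy
      · rintro rfl
        exact hB x
      -- The 2 r - 2 variables give the upper index p + 2 r - 4, one less than in the stated bound.
      · exact Nat.add_le_add_right
          (Nat.pow_le_pow_left (Nat.choose_le_choose _ (by omega)) h) 1
  · intro K _ V _ _ _ Q O n ε hK hV hε hnε hn hrank hO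
    have hfin : Finite K := Nat.finite_of_card_ne_zero (by omega)
    rw [← isElement_polarBilin] at hrank hO
    obtain ⟨m, hm, hmbound⟩ : ∃ m : ℕ,
        ((m : ℤ) = (binom (n + p - 4) (p - 1) - binom (n + p - 6) (p - 3)) ^ h) ∧
        ∀ (e : Fin (Module.finrank K V - 2) → V) (s : Finset V),
          (∀ x ∈ s, x ∈ Submodule.span K (Set.range e)) → (∀ x ∈ s, x ∈ {x | Q x = 0}) →
          (∀ x ∈ s, ∀ y ∈ s, x ≠ y → Q.polarBilin x y ≠ 0) → s.card ≤ m + 1 := by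
      rw [hbinom1]
      rcases Nat.lt_or_ge p 3 with hp3 | hp3
      -- For p = 2 the functions are linear, so there are no multiples of Q to subtract and the
      -- second binomial is 0; the symplectic argument applies to the polar form.
      · refine ⟨(n + p - 4).choose (p - 1) ^ h, ?_, fun e s hs hZ hne => ?_⟩
        · rw [binom, if_neg (by omega), sub_zero]
          push_cast
          rfl
        · have := card_le_symplectic hh.ne' (hK.trans hq) Q.polarBilin hs
            fun x hx y hy => ⟨fun hxy => by_contra fun h => hne x hx y hy h hxy, fun hxy => by
              subst hxy
              exact (isPolarForm_polarBilin hn).apply_self x (hZ x hx)⟩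
          rwa [hV, show n - 2 + (p - 1) - 1 = n + p - 4 by omega] at this
      · have hle : (n + p - 6).choose (p - 3) ≤ (n + p - 4).choose (p - 1) := by
          rw [show n + p - 4 = n + p - 6 + 1 + 1 by omega, show p - 1 = p - 3 + 1 + 1 by omega,
            Nat.choose_succ_succ, Nat.choose_succ_succ]
          omega
        refine ⟨((n + p - 4).choose (p - 1) - (n + p - 6).choose (p - 3)) ^ h, ?_,
          fun e s hs hZ hne => ?_⟩
        · have : binom (n + p - 6) ((p : ℤ) - 3) = (n + p - 6).choose (p - 3) := by
            rw [← hbinom]; congr; omega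
          rw [this, Nat.cast_pow, Nat.cast_sub hle]
        · have := card_le_quadric hh.ne' (hK.trans hq) hp3 Q hs hZ hne
          rwa [hV, show n - 2 + (p - 1) - 1 = n + p - 4 by omega,
            show n - 2 + (p - 3) - 1 = n + p - 6 by omega] at this
    have hbound := (isPolarForm_polarBilin hn).ncard_le_of_isPartialOvoid hrank (by omega)
      (E := q ^ ((r : ℤ) - ε).toNat) (m := m)
      (by rw [hK, hV, one_mul, ← pow_add]; congr 1; omega) hmbound hO
    rw [hK] at hbound
    rw [← hm]
    zify at hbound
    linarith
  · intro K _ V _ _ _ σ B O n hK hV hσ hB hn hrank hO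
    have hfin : Finite K := Nat.finite_of_card_ne_zero (by rw [hK]; positivity)
    have hdim := finrank_le_of_hermitian hp hh.ne' hq hK hσ hB hn hrank
    have hpol := isPolarForm_hermitian hp hh.ne' hq hK hσ hB hn
    rw [← isElement_hermitian] at hrank hO
    have hlt := hpol.rank_lt_finrank hrank (by omega)
    rw [hV] at hdim hlt
    have hle : (n + p - 5).choose (p - 2) ≤ (n + p - 4).choose (p - 1) := by
      rw [show n + p - 4 = n + p - 5 + 1 by omega, show p - 1 = p - 2 + 1 by omega,
        Nat.choose_succ_succ]
      omega
    have hbound := hpol.ncard_le_of_isPartialOvoid hrank (by omega) (E := q ^ (2 * n - 2 * r - 1))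
      (m := ((n + p - 4).choose (p - 1) ^ 2 - (n + p - 5).choose (p - 2) ^ 2) ^ h)
      (by rw [hK, hV, ← pow_mul, ← pow_mul, ← pow_succ', ← pow_add]; congr 1; omega)
      (fun e s hs hZ hne => by
        have := card_le_hermitian hh.ne' (by rw [hK, hq]) (by simpa only [hq] using hσ) B hs hZ hne
        rwa [hV, show n - 2 + (p - 1) - 1 = n + p - 4 by omega,
          show n - 2 + (p - 2) - 1 = n + p - 5 by omega] at this) hO
    -- Since n ≤ 2 r + 1, the exponent 2 n - 2 r - 1 is at most 2 r + 1, and at most 2 r - 1 when n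
    -- is even, as then n ≤ 2 r.
    have hfinal : ∀ k, 2 * n - 2 * r - 1 ≤ k → (O.ncard : ℤ) ≤ (q : ℤ) ^ k + q ^ 2 + 1
        + q ^ 2 * (binom (n + p - 4) (p - 1) ^ 2 - binom (n + p - 5) (p - 2) ^ 2) ^ h := by
      intro k hk
      have hpow : (q : ℤ) ^ (2 * n - 2 * r - 1) ≤ (q : ℤ) ^ k :=
        pow_le_pow_right₀ (by exact_mod_cast hq1.le) hk
      rw [hbinom1, hbinom2]
      rw [hK] at hbound
      zify [Nat.pow_le_pow_left hle 2] at hbound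
      linarith
    refine ⟨fun _ => hfinal _ (by omega), fun heven => hfinal _ ?_⟩
    obtain ⟨l, hl⟩ := heven
    omega
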